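/- A digraph $\mathbb A=(A;\to)$ is a set $A$ with a binary relation $\to$. It is smooth if every vertex has at least one outgoing and at least one incoming edge, and it has a loop if $a\to a$ for some $a$. It has algebraic length $1$ if there is a closed walk $a_1\,\epsilon_1\,a_2\,\epsilon_2\cdots\epsilon_{n-1}\,a_n=a_1$, with each $\epsilon_i\in\{\to,\leftarrow\}$, in which the number of forward arrows minus the number of backward arrows is $1$. For a group $G$ of automorphisms of $\mathbb A$, the factor graph $\mathbb A/G$ is the digraph whose vertices are the orbits of $G$ on $A$, with an edge from an orbit $O$ to an orbit $O'$ if and only if $a\to b$ for some $a\in O$ and $b\in O'$. A primitive positive (pp) formula is a first-order formula built from atomic formulas (including equalities) using only conjunction and existential quantification. A pp-interpretation of a relational structure $\mathbb B$ in a relational structure $\mathbb A$ is a partial surjective map $h\colon A^d\to B$, for some $d\ge 1$, such that for every $R\subseteq B^n$ that is either $B$ itself, or the equality relation on $B$, or a relation of $\mathbb B$, the preimage $h^{-1}(R)$, seen as a relation of arity $nd$ on $A$, is definable by a pp-formula in $\mathbb A$. The structure $\mathbb A$ pp-interprets $\mathbb B$ with parameters if the expansion of $\mathbb A$ by all unary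 relations $\{a\}$, $a\in A$, pp-interprets $\mathbb B$. **Theorem.** Let $\mathbb A$ be a finite smooth digraph and let $G$ be a subgroup of its automorphism group $\operatorname{Aut}(\mathbb A)$. If the factor graph $\mathbb A/G$ has algebraic length $1$ and no loop, then $\mathbb A$ pp-interprets with parameters every finite relational structure. -/

import Mathlib

open FirstOrder

/-! ### Primitive positive formulas, definability and interpretations -/

/-- Primitive positive formulas: built from atomic formulas (equalities and relational atoms)
using only conjunction and existential quantification. -/
inductive IsPP {L : Language} {α : Type*} : {n : ℕ} → L.BoundedFormula α n → Prop
  | atomic {n : ℕ} {φ : L.BoundedFormula α n} (h : φ.IsAtomic) : IsPP φ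
  | conj {n : ℕ} {φ ψ : L.BoundedFormula α n} (hφ : IsPP φ) (hψ : IsPP ψ) : IsPP (φ ⊓ ψ)
  | exists' {n : ℕ} {φ : L.BoundedFormula α (n + 1)} (h : IsPP φ) : IsPP φ.ex

/-- A relation on `M` whose coordinates are indexed by `α` is pp-definable in the
`L`-structure `M` if it is defined by a pp-formula with free variables in `α`. -/
def PPDefinable (L : Language) {M : Type*} [L.Structure M] {α : Type*}
    (S : Set (α → M)) : Prop :=
  ∃ φ : L.Formula α, IsPP φ ∧ ∀ x : α → M, x ∈ S ↔ φ.Realize x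

/-- The preimage of an `n`-ary relation `R` on `N` under a partial map `h` from `M ^ d` to `N`,
seen as a relation of arity `n * d` on `M` (with coordinates indexed by `Fin n × Fin d`). -/
def relPreimage {M N : Type*} {d n : ℕ} (h : (Fin d → M) →. N) (R : Set (Fin n → N)) :
    Set (Fin n × Fin d → M) :=
  {x | ∃ b ∈ R, ∀ i : Fin n, b i ∈ h (fun j => x (i, j))}

/-- The `L`-structure `M` pp-interprets the `L'`-structure `N`: for some `d ≥ 1` there is a partial
surjective map from `M ^ d` to `N` such that the preimages of `N`, of the equality relation
on `N`, and of every relation of `N` are pp-definable in `M`. -/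
def PPInterprets (L : Language) (M : Type*) [L.Structure M]
    (L' : Language) (N : Type*) [L'.Structure N] : Prop :=
  ∃ d : ℕ, 1 ≤ d ∧ ∃ h : (Fin d → M) →. N,
    (∀ b : N, ∃ x, b ∈ h x) ∧
    PPDefinable L (relPreimage h (Set.univ : Set (Fin 1 → N))) ∧
    PPDefinable L (relPreimage h {b : Fin 2 → N | b 0 = b 1}) ∧
    ∀ (n : ℕ) (R : L'.Relations n),
      PPDefinable L (relPreimage h {b : Fin n → N | Language.Structure.RelMap R b})

/-- One unary relation symbol for each element of `M`. -/
inductive PointRel (M : Type*) : ℕ → Type _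
  | point (a : M) : PointRel M 1

/-- The relational language with one unary relation symbol for each element of `M`. -/
def pointLanguage (M : Type*) : Language := ⟨fun _ => Empty, PointRel M⟩

/-- The symbol attached to `a` is interpreted as the unary relation `{a}`. -/
instance pointStructure (M : Type*) : (pointLanguage M).Structure M where
  funMap f := nomatch f
  RelMap
    | PointRel.point a => fun x => x 0 = a

/-- pp-interpretation with parameters: `M` expanded by all unary relations `{a}`, for `a` in `M`,
pp-interprets `N`. -/
def PPInterpretsWithParameters (L : Language) (M : Type*) [L.Structure M]
    (L' : Language) (N : Type*) [L'.Structure N] : Prop :=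
  PPInterprets (L.sum (pointLanguage M)) M L' N

/-! ### Digraphs -/

namespace Digraph

variable {V : Type*}

/-- A digraph as a relational structure with a single binary relation. -/
@[reducible] def toStructure (A : Digraph V) : Language.graph.Structure V where
  RelMap
    | Language.graphRel.adj => fun x => A.Adj (x 0) (x 1)

/-- Every vertex has an outgoing and an incoming edge. -/
def IsSmooth (A : Digraph V) : Prop :=
  ∀ a : V, (∃ b, A.Adj a b) ∧ (∃ b, A.Adj b a)

/-- Some vertex has an edge to itself. -/
def HasLoop (A : Digraph V) : Prop := ∃ a : V, A.Adj a a

/-- Walks, in which every edge is traversed forwards or backwards. -/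
inductive Walk (A : Digraph V) : V → V → Type _
  | nil (a : V) : Walk A a a
  | forward {a b c : V} (h : A.Adj a b) (w : Walk A b c) : Walk A a c
  | backward {a b c : V} (h : A.Adj b a) (w : Walk A b c) : Walk A a c

/-- The number of forward edges minus the number of backward edges. -/
def Walk.algLength {A : Digraph V} : {a b : V} → A.Walk a b → ℤ
  | _, _, .nil _ => 0
  | _, _, .forward _ w => w.algLength + 1
  | _, _, .backward _ w => w.algLength - 1

/-- There is a closed walk of algebraic length `1`. -/
def HasAlgLengthOne (A : Digraph V) : Prop :=
  ∃ (a : V) (w : A.Walk a a), w.algLength = 1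

/-- The quotient of a digraph by an equivalence relation on its vertices. -/
def quotient (A : Digraph V) (s : Setoid V) : Digraph (Quotient s) where
  Adj x y := ∃ a b : V, Quotient.mk s a = x ∧ Quotient.mk s b = y ∧ A.Adj a b

/-- The automorphism group of a digraph, as a group of permutations of its vertices. -/
def aut (A : Digraph V) : Subgroup (Equiv.Perm V) where
  carrier := {g | ∀ a b : V, A.Adj (g a) (g b) ↔ A.Adj a b}
  one_mem' _ _ := Iff.rfl
  mul_mem' hf hg a b := (hf _ _).trans (hg a b)
  inv_mem' {g} hg a b := by
    rw [← hg (g⁻¹ a) (g⁻¹ b)]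
    simp

/-- The factor digraph on the orbits of a group of permutations of the vertices. -/
def factor (A : Digraph V) (G : Subgroup (Equiv.Perm V)) :
    Digraph (MulAction.orbitRel.Quotient G V) :=
  A.quotient (MulAction.orbitRel G V)

/-- The digraph, expanded by all unary relations `{a}`, pp-interprets the structure `N`. -/
def PPInterpretsWithParams (A : Digraph V) (L' : Language) (N : Type*) [L'.Structure N] : Prop :=
  letI := A.toStructure
  PPInterpretsWithParameters Language.graph V L' N

end Digraph

-- If every idempotent polymorphism acts as a projection on a two-block partition of some
-- subuniverse (`Projective`), then block patterns encode the elements of any finite structure,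
-- every relation between codes is invariant, and invariant relations are pp-definable with
-- parameters. So assume this fails; it remains to find an edge x → g x with g in G, a loop of the
-- factor.
--
-- For a large walk length, edges permute the linkedness classes of the digraph. Algebraic length 1
-- of the factor yields a class B and some g in G such that edges leave B only into g B. Hence x → g
-- y defines a smooth linked digraph on B, invariant up to conjugating polymorphisms by g. This is a
-- `GoodPair`; take B inclusion-minimal for this g.
--
-- A proper absorbing subuniverse of B would yield a smaller good pair
-- (`GoodPair.exists_ssubset_of_absorbing`), so B is absorption free. By the absorption theorem
-- (`full_of_linked`), walks of length k ≥ 1 that link B join any two of its vertices. Take the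
-- least such k. If k > 1, walks of length k - 1 do not link B, and one of their linkedness classes
-- contains a smaller good pair (`GoodPair.exists_ssubset_of_full_steps`). So k = 1 and the twisted
-- digraph on B is complete, loops included.

universe u

/-! ### Idempotent polymorphisms -/

section Polymorphisms

variable {V : Type u} {E : V → V → Prop}

/-- Idempotent polymorphisms of a binary relation, with coordinates indexed by `ι`. -/
structure IsPol (E : V → V → Prop) {ι : Type u} (f : (ι → V) → V) : Prop where
  idem : ∀ a, f (fun _ => a) = a
  pres : ∀ x y : ι → V, (∀ i, E (x i) (y i)) → E (f x) (f y)

/-- Subsets closed under all idempotent polymorphisms. -/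
def IsSub (E : V → V → Prop) (S : Set V) : Prop :=
  ∀ (ι : Type u) [Finite ι] (f : (ι → V) → V), IsPol E f →
    ∀ x : ι → V, (∀ i, x i ∈ S) → f x ∈ S

/-- Binary relations closed under all idempotent polymorphisms. -/
def IsSubRel (E R : V → V → Prop) : Prop :=
  ∀ (ι : Type u) [Finite ι] (f : (ι → V) → V), IsPol E f →
    ∀ x y : ι → V, (∀ i, R (x i) (y i)) → R (f x) (f y)

/-- `f` maps every tuple from `B` with at most one entry outside `X` into `X`. -/
def PolAbsorbs {ι : Type u} (f : (ι → V) → V) (X B : Set V) : Prop :=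
  ∀ (x : ι → V) (i : ι), (∀ j, j ≠ i → x j ∈ X) → x i ∈ B → f x ∈ X

/-- `B` has no proper nonempty absorbing subuniverse. -/
def AbsFree (E : V → V → Prop) (B : Set V) : Prop :=
  ∀ X : Set V, X ⊆ B → X.Nonempty → IsSub E X →
    ∀ (ι : Type u) [Finite ι] (f : (ι → V) → V), IsPol E f → PolAbsorbs f X B → X = B

/-- Some subuniverse has a partition into two parts on which every idempotent polymorphism acts
as a projection. -/
def Projective (E : V → V → Prop) : Prop :=
  ∃ C D : Set V, IsSub E C ∧ (∃ c ∈ C, c ∉ D) ∧ (∃ d ∈ C, d ∈ D) ∧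
    ∀ (ι : Type u) [Finite ι] (f : (ι → V) → V), IsPol E f →
      ∃ i, ∀ x : ι → V, (∀ j, x j ∈ C) → (f x ∈ D ↔ x i ∈ D)

/-- The star composition of two operations. -/
def starOp {ι κ : Type u} (f : (ι → V) → V) (h : (κ → V) → V) : (ι × κ → V) → V :=
  fun x => f fun i => h fun j => x (i, j)

theorem IsPol.comp {ι κ : Type u} {f : (ι → V) → V} {h : ι → (κ → V) → V} (hf : IsPol E f)
    (hh : ∀ i, IsPol E (h i)) : IsPol E (fun x => f fun i => h i x) where
  idem a := by simp [(hh _).idem, hf.idem]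
  pres x y hxy := hf.pres _ _ fun i => (hh i).pres _ _ hxy

theorem IsPol.star {ι κ : Type u} {f : (ι → V) → V} {h : (κ → V) → V} (hf : IsPol E f)
    (hh : IsPol E h) : IsPol E (starOp f h) where
  idem a := by simp [starOp, hh.idem, hf.idem]
  pres x y hxy := hf.pres _ _ fun i => hh.pres _ _ fun j => hxy (i, j)

theorem IsPol.proj {ι : Type u} (i : ι) : IsPol E (fun x : ι → V => x i) where
  idem _ := rfl
  pres _ _ h := h i

theorem PolAbsorbs.star_left {ι κ : Type u} {f : (ι → V) → V} {h : (κ → V) → V} {X B : Set V}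
    [Finite κ] (hX : IsSub E X) (hB : IsSub E B) (hXB : X ⊆ B) (hh : IsPol E h)
    (hf : PolAbsorbs f X B) : PolAbsorbs (starOp f h) X B := by
  rintro x ⟨i, j⟩ hx hi
  refine hf _ i (fun i' hi' => hX κ h hh _ fun j' => hx _ (by simp [hi'])) (hB κ h hh _ fun j' => ?_)
  by_cases hj : j' = j
  · exact hj ▸ hi
  · exact hXB (hx _ (by simp [hj]))

theorem PolAbsorbs.star_right {ι κ : Type u} {f : (ι → V) → V} {h : (κ → V) → V} {X B : Set V}
    [Finite ι] (hX : IsSub E X) (hXB : X ⊆ B) (hf : IsPol E f)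
    (hh : PolAbsorbs h X B) : PolAbsorbs (starOp f h) X B := by
  rintro x ⟨i, j⟩ hx hi
  refine hX ι f hf _ fun i' => hh _ j (fun j' hj' => hx _ (by simp [hj'])) ?_
  by_cases hi' : i' = i
  · exact hi' ▸ hi
  · exact hXB (hx _ (by simp [hi']))

/-! ### Transitive operations -/

/-- The value `c` is attained by `f` on tuples from `C` with `i`-th entry `b`. -/
def Reach {ι : Type u} (C : Set V) (f : (ι → V) → V) (i : ι) (b c : V) : Prop :=
  ∃ x : ι → V, (∀ j, x j ∈ C) ∧ x i = b ∧ f x = c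

theorem Reach.star_left {ι κ : Type u} {C : Set V} {f : (ι → V) → V} {h : (κ → V) → V}
    (hh : IsPol E h) {i : ι} {b c : V} (H : Reach C f i b c) (j : κ) :
    Reach C (starOp f h) (i, j) b c := by
  obtain ⟨x, hx, hi, rfl⟩ := H
  exact ⟨fun p => x p.1, fun p => hx p.1, hi, by simp [starOp, hh.idem]⟩

theorem Reach.star_right {ι κ : Type u} {C : Set V} {f : (ι → V) → V} {h : (κ → V) → V}
    (hf : IsPol E f) {j : κ} {b c : V} (H : Reach C h j b c) (i : ι) :
    Reach C (starOp f h) (i, j) b c := by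
  obtain ⟨x, hx, hi, rfl⟩ := H
  exact ⟨fun p => x p.2, fun p => hx p.2, hi, by simp [starOp, hf.idem]⟩

/-- Each coordinate (i, j) of a star composition reaches whatever i reaches in the outer factor and
j in the inner one, so finitely many monotone requirements can be met by one polymorphism. -/
theorem exists_pol_forall_reach {C : Set V} {τ : Type*} [Finite τ]
    (Φ : τ → (V → V → Prop) → Prop)
    (mono : ∀ p r r', (∀ b c, r b c → r' b c) → Φ p r → Φ p r')
    (H : ∀ p, ∃ (ι : Type u) (_ : Finite ι) (f : (ι → V) → V), IsPol E f ∧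
      ∀ i, Φ p (Reach C f i)) :
    ∃ (ι : Type u) (_ : Finite ι) (f : (ι → V) → V), IsPol E f ∧
      ∀ p i, Φ p (Reach C f i) := by
  classical
  have key : ∀ S : Finset τ, ∃ (ι : Type u) (_ : Finite ι) (f : (ι → V) → V), IsPol E f ∧
      ∀ p ∈ S, ∀ i, Φ p (Reach C f i) := by
    intro S
    induction S using Finset.induction_on with
    | empty => exact ⟨PUnit, inferInstance, _, IsPol.proj PUnit.unit, by simp⟩
    | insert p S _ ih =>
      obtain ⟨ι, _, f, hf, hfS⟩ := ih
      obtain ⟨κ, _, h, hh, hhp⟩ := H p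
      refine ⟨ι × κ, inferInstance, starOp f h, hf.star hh, ?_⟩
      rintro q hq ⟨i, j⟩
      rcases Finset.mem_insert.1 hq with rfl | hq
      · exact mono _ _ _ (fun b c hr => hr.star_right hf i) (hhp j)
      · exact mono _ _ _ (fun b c hr => hr.star_left hh j) (hfS q hq i)
  have := Fintype.ofFinite τ
  obtain ⟨ι, hι, f, hf, h⟩ := key Finset.univ
  exact ⟨ι, hι, f, hf, fun p => h p (Finset.mem_univ _)⟩

/-- If no polymorphism is transitive on `C`, then some nonempty proper subset `D` of `C` is such
that the membership of a single coordinate in `D` forces the value of a polymorphism into `D`. -/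
theorem exists_dictators [Finite V] {C : Set V} (hC : IsSub E C)
    (H : ¬ ∃ (ι : Type u) (_ : Finite ι) (t : (ι → V) → V), IsPol E t ∧
      ∀ i, ∀ b ∈ C, ∀ c ∈ C, Reach C t i b c) :
    ∃ D ⊆ C, D.Nonempty ∧ D ≠ C ∧ ∀ (ι : Type u) [Finite ι] (f : (ι → V) → V), IsPol E f →
      ∃ i, ∀ x : ι → V, (∀ j, x j ∈ C) → x i ∈ D → f x ∈ D := by
  classical
  obtain ⟨b, hb, c, hc, hbc⟩ : ∃ b ∈ C, ∃ c ∈ C, ∀ (ι : Type u) [Finite ι] (f : (ι → V) → V),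
      IsPol E f → ∃ i, ¬ Reach C f i b c := by
    by_contra! hcon
    apply H
    obtain ⟨ι, hι, f, hf, hr⟩ := exists_pol_forall_reach (E := E) (C := C) (τ := C × C)
      (fun p r => r p.1 p.2) (fun p r r' h => h _ _)
      (fun p => by
        obtain ⟨ι, hι, f, hf, h⟩ := hcon p.1 p.1.2 p.2 p.2.2
        exact ⟨ι, hι, f, hf, h⟩)
    exact ⟨ι, hι, f, hf, fun i b hb c hc => hr (⟨b, hb⟩, ⟨c, hc⟩) i⟩
  -- A minimal set trapping, for every polymorphism, all values reachable from b at some coordinate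
  -- will be the dictated set.
  let Φ : Set V → Prop := fun D => D ⊆ C \ {c} ∧
    ∀ (ι : Type u) [Finite ι] (f : (ι → V) → V), IsPol E f → ∃ i, ∀ e, Reach C f i b e → e ∈ D
  have h0 : Φ (C \ {c}) := by
    refine ⟨subset_rfl, fun ι _ f hf => ?_⟩
    obtain ⟨i, hi⟩ := hbc ι f hf
    refine ⟨i, fun e he => ⟨?_, ?_⟩⟩
    · obtain ⟨x, hx, -, rfl⟩ := he
      exact hC ι f hf x hx
    · rintro rfl
      exact hi he
  obtain ⟨D, hD⟩ := exists_minimal_of_wellFoundedLT Φ ⟨_, h0⟩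
  obtain ⟨hDC, hDΦ⟩ := hD.prop
  have hbD : b ∈ D := by
    obtain ⟨i, hi⟩ := hDΦ PUnit _ (IsPol.proj PUnit.unit)
    exact hi b ⟨fun _ => b, fun _ => hb, rfl, rfl⟩
  refine ⟨D, hDC.trans Set.sdiff_subset, ⟨b, hbD⟩, fun h => (hDC (h ▸ hc)).2 rfl, fun κ _ h hh => ?_⟩
  by_contra! hcon
  -- By minimality no D \ {d} is a trap; so a coordinate of this f that stays in D must reach all of
  -- D from b.
  obtain ⟨ι, _, f, hf, hr⟩ := exists_pol_forall_reach (E := E) (C := C) (τ := D)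
    (fun d r => ∃ e, r b e ∧ e ∉ D \ {d.1}) (fun p r r' h ⟨e, he, he'⟩ => ⟨e, h _ _ he, he'⟩)
    (fun d => by
      by_contra! hcon
      have hΦ : Φ (D \ {d.1}) := by
        refine ⟨Set.sdiff_subset.trans hDC, fun ι _ f hf => ?_⟩
        obtain ⟨i, hi⟩ := hcon ι inferInstance f hf
        exact ⟨i, hi⟩
      exact (hD.le_of_le hΦ Set.sdiff_subset d.2).2 rfl)
  obtain ⟨⟨i, j⟩, hij⟩ := hDΦ (κ × ι) (starOp h f) (hh.star hf)
  have hsub : ∀ e, Reach C f j b e → e ∈ D := fun e he => hij e (he.star_right hh i)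
  have hall : ∀ d ∈ D, Reach C f j b d := by
    intro d hd
    obtain ⟨e, he, he'⟩ := hr ⟨d, hd⟩ j
    have := hsub e he
    obtain rfl : e = d := by simpa [this] using he'
    exact he
  obtain ⟨x, hx, hxi, hxD⟩ := hcon i
  obtain ⟨y, hy, hyj, hfy⟩ := hall _ hxi
  -- Block i evaluates to x i starting from b at coordinate j; the other blocks are constant. The
  -- composite thus takes the value h x outside the trap.
  refine hxD (hij _ ⟨fun p => if p.1 = i then y p.2 else x p.1, ?_, by simpa using hyj, ?_⟩)
  · rintro ⟨i', j'⟩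
    dsimp only
    split_ifs
    exacts [hy _, hx _]
  · simp only [starOp]
    congr 1
    funext i'
    by_cases h' : i' = i
    · subst h'
      simpa using hfy
    · simp [h', hf.idem]

/-- Binary operations obtained from polymorphisms. -/
def IsPol₂ (E : V → V → Prop) (p : V → V → V) : Prop :=
  IsPol E fun x : ULift.{u} Bool → V => p (x ⟨false⟩) (x ⟨true⟩)

theorem IsPol.comp₂ {ι : Type u} {f : (ι → V) → V} {p : ι → V → V → V} (hf : IsPol E f)
    (hp : ∀ i, IsPol₂ E (p i)) : IsPol₂ E (fun a b => f fun i => p i a b) :=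
  IsPol.comp hf hp

theorem IsPol₂.fst : IsPol₂ E (fun a _ => a) := IsPol.proj _

theorem IsPol₂.snd : IsPol₂ E (fun _ b => b) := IsPol.proj _

theorem IsPol₂.comp {p q r : V → V → V} (hp : IsPol₂ E p) (hq : IsPol₂ E q) (hr : IsPol₂ E r) :
    IsPol₂ E (fun a b => p (q a b) (r a b)) := by
  have := IsPol.comp₂ (p := fun i => if i.down then r else q) hp (by rintro ⟨_ | _⟩ <;> assumption)
  simpa using this

/-- A set with dictators yields an absorbing set or a projective factor. -/
theorem projective_of_dictators [Finite V] {C D : Set V} (hC : IsSub E C) (hfree : AbsFree E C)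
    (hDC : D ⊆ C) (hDne : D.Nonempty) (hD : D ≠ C)
    (H : ∀ (ι : Type u) [Finite ι] (f : (ι → V) → V), IsPol E f →
      ∃ i, ∀ x : ι → V, (∀ j, x j ∈ C) → x i ∈ D → f x ∈ D) : Projective E := by
  classical
  have hDsub : IsSub E D := fun ι _ f hf x hx => by
    obtain ⟨i, hi⟩ := H ι f hf
    exact hi x (fun j => hDC (hx j)) (hx i)
  have hC₂ : ∀ {p}, IsPol₂ E p → ∀ {a b}, a ∈ C → b ∈ C → p a b ∈ C := by
    intro p hp a b ha hb
    exact hC _ _ hp (fun i => if i.down then b else a) (by rintro ⟨_ | _⟩ <;> simpa)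
  let dict : (V → V → V) → Prop := fun p => IsPol₂ E p ∧ ∀ a ∈ D, ∀ b ∈ C, p a b ∈ D
  -- Otherwise a p sending as many pairs of C × D as possible into D sends them all there: composing
  -- with q(p(a, b), b) repairs any bad pair. Then p witnesses that D absorbs C.
  obtain ⟨c, hc, d, hd, hcd⟩ : ∃ c ∈ C \ D, ∃ d ∈ D, ∀ p, dict p → p c d ∉ D := by
    by_contra! hcon
    obtain ⟨p, hp, hmax⟩ : ∃ p, dict p ∧ ∀ q, dict q →
        ¬ {z : V × V | z.1 ∈ C ∧ z.2 ∈ D ∧ p z.1 z.2 ∈ D} ⊂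
          {z : V × V | z.1 ∈ C ∧ z.2 ∈ D ∧ q z.1 z.2 ∈ D} := by
      obtain ⟨S, hS⟩ := exists_maximal_of_wellFoundedGT
        (fun S : Set (V × V) => ∃ p, dict p ∧ S = {z : V × V | z.1 ∈ C ∧ z.2 ∈ D ∧ p z.1 z.2 ∈ D})
        ⟨_, fun a _ => a, ⟨IsPol₂.fst, fun a ha b hb => ha⟩, rfl⟩
      obtain ⟨⟨p, hp, rfl⟩, hS⟩ := hS
      exact ⟨p, hp, fun q hq hlt => hlt.2 (hS ⟨q, hq, rfl⟩ hlt.1)⟩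
    have hall : ∀ c ∈ C, ∀ d ∈ D, p c d ∈ D := by
      by_contra! hbad
      obtain ⟨c, hc, d, hd, hbad⟩ := hbad
      obtain ⟨q, hq, hqD⟩ := hcon (p c d) ⟨hC₂ hp.1 hc (hDC hd), hbad⟩ d hd
      refine hmax (fun a b => q (p a b) b)
        ⟨hq.1.comp hp.1 IsPol₂.snd, fun a ha b hb => hq.2 _ (hp.2 a ha b hb) b hb⟩
        ((Set.ssubset_iff_of_subset ?_).2 ⟨(c, d), ⟨hc, hd, hqD⟩, fun h => hbad h.2.2⟩)
      rintro ⟨a, b⟩ ⟨ha, hb, hab⟩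
      exact ⟨ha, hb, hq.2 _ hab _ (hDC hb)⟩
    refine hD (hfree D hDC hDne hDsub _ _ hp.1 ?_)
    rintro x ⟨_ | _⟩ hx hi
    · exact hall _ hi _ (hx ⟨true⟩ (by simp))
    · exact hp.2 _ (hx ⟨false⟩ (by simp)) _ hi
  have hpair : ∀ p, IsPol₂ E p → dict p ∨ (∀ a ∈ C, ∀ b ∈ D, p a b ∈ D) := by
    intro p hp
    obtain ⟨⟨_ | _⟩, hi⟩ := H _ _ hp
    · left
      refine ⟨hp, fun a ha b hb => ?_⟩
      exact hi (fun i => if i.down then b else a) (by rintro ⟨_ | _⟩; exacts [hDC ha, hb]) ha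
    · right
      intro a ha b hb
      exact hi (fun i => if i.down then b else a) (by rintro ⟨_ | _⟩; exacts [ha, hDC hb]) hb
  -- In the subuniverse generated by c and d, membership of p(c, d) in D tells which argument of p
  -- dictates.
  refine ⟨{x | ∃ p, IsPol₂ E p ∧ x = p c d}, D, ?_, ⟨c, ⟨_, IsPol₂.fst, rfl⟩, hc.2⟩,
    ⟨d, ⟨_, IsPol₂.snd, rfl⟩, hd⟩, ?_⟩
  · intro ι _ f hf x hx
    choose p hp hxp using hx
    obtain rfl : x = fun i => p i c d := funext hxp
    exact ⟨_, hf.comp₂ hp, rfl⟩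
  · intro ι _ f hf
    obtain ⟨i, hi⟩ := H ι f hf
    refine ⟨i, fun x hx => ?_⟩
    choose p hp hxp using hx
    rcases hpair _ (hp i) with h | h
    · have h1 : f x ∉ D := by
        have := hcd (fun a b => f fun i => p i a b) ⟨hf.comp₂ hp, fun a ha b hb =>
          hi _ (fun j => hC₂ (hp j) (hDC ha) hb) (h.2 a ha b hb)⟩
        simpa [← hxp] using this
      have h2 : x i ∉ D := by
        rw [hxp]
        exact hcd _ h
      simp [h1, h2]
    · have h2 : x i ∈ D := by
        rw [hxp]
        exact h c hc.1 d hd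
      refine ⟨fun _ => h2, fun _ => hi x (fun j => ?_) h2⟩
      rw [hxp]
      exact hC₂ (hp j) hc.1 (hDC hd)

theorem exists_transitive [Finite V] (hE : ¬ Projective E) {C : Set V} (hC : IsSub E C)
    (hfree : AbsFree E C) :
    ∃ (ι : Type u) (_ : Finite ι) (t : (ι → V) → V), IsPol E t ∧
      ∀ i, ∀ b ∈ C, ∀ c ∈ C, Reach C t i b c := by
  by_contra H
  obtain ⟨D, hDC, hDne, hD, h⟩ := exists_dictators hC H
  exact hE (projective_of_dictators hC hfree hDC hDne hD h)

/-! ### The absorption theorem -/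

theorem IsSubRel.flip {R : V → V → Prop} (hR : IsSubRel E R) : IsSubRel E fun x y => R y x :=
  fun ι _ f hf x y h => hR ι f hf y x h

/-- The left center of a relation is empty or everything. -/
theorem center_eq [Finite V] (hE : ¬ Projective E) {P Q : Set V} {R : V → V → Prop}
    (hP : IsSub E P) (hQ : IsSub E Q) (hPfree : AbsFree E P) (hQfree : AbsFree E Q)
    (hR : IsSubRel E R) (hl : ∀ a ∈ P, ∃ q ∈ Q, R a q) {a₀ : V} (ha₀ : a₀ ∈ P)
    (hc : ∀ q ∈ Q, R a₀ q) : ∀ a ∈ P, ∀ q ∈ Q, R a q := by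
  obtain ⟨ι, _, t, ht, hr⟩ := exists_transitive hE hQ hQfree
  have hsub : IsSub E {a | a ∈ P ∧ ∀ q ∈ Q, R a q} := by
    refine fun κ _ f hf x hx => ⟨hP κ f hf x fun i => (hx i).1, fun q hq => ?_⟩
    have := hR κ f hf x (fun _ => q) fun i => (hx i).2 q hq
    rwa [hf.idem] at this
  -- A transitive t absorbs P into the center: a neighbour of the one outside entry extends to a
  -- tuple in Q with any prescribed value of t, and central entries are related to all of Q.
  have := hPfree {a | a ∈ P ∧ ∀ q ∈ Q, R a q} (fun a ha => ha.1) ⟨a₀, ha₀, hc⟩ hsub ι t ht ?_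
  · intro a ha
    rw [← this] at ha
    exact ha.2
  · intro x i hx hi
    refine ⟨hP ι t ht x fun j => ?_, fun q hq => ?_⟩
    · by_cases h : j = i
      · exact h ▸ hi
      · exact (hx j h).1
    · obtain ⟨b, hb, hib⟩ := hl _ hi
      obtain ⟨y, hy, rfl, rfl⟩ := hr i b hb q hq
      refine hR ι t ht x y fun j => ?_
      by_cases h : j = i
      · exact h ▸ hib
      · exact (hx j h).2 _ (hy j)

/-- A neighbour common to all of P lies in the center of the converse relation, so `center_eq`
applies. Otherwise a smallest set U without a common neighbour has three distinct elements u, v, w,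
and a second use of `center_eq` contradicts its choice. -/
theorem full_of_comp_full [Finite V] (hE : ¬ Projective E) {P Q : Set V} {S : V → V → Prop}
    (hP : IsSub E P) (hQ : IsSub E Q) (hPfree : AbsFree E P) (hQfree : AbsFree E Q)
    (hS : IsSubRel E S) (hr : ∀ q ∈ Q, ∃ a ∈ P, S a q)
    (hSS : ∀ a ∈ P, ∀ b ∈ P, ∃ q ∈ Q, S a q ∧ S b q) : ∀ a ∈ P, ∀ q ∈ Q, S a q := by
  classical
  by_cases hcom : ∃ q ∈ Q, ∀ a ∈ P, S a q
  · obtain ⟨q, hq, h⟩ := hcom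
    have := center_eq hE hQ hP hQfree hPfree hS.flip hr hq h
    exact fun a ha q hq => this q hq a ha
  · obtain ⟨U, ⟨hUP, hUc⟩, hmin⟩ : ∃ U : Set V, (U ⊆ P ∧ ¬ ∃ q ∈ Q, ∀ a ∈ U, S a q) ∧
        ∀ W ⊆ P, W.ncard < U.ncard → ∃ q ∈ Q, ∀ a ∈ W, S a q := by
      have hex : ∃ n, ∃ U : Set V, (U ⊆ P ∧ ¬ ∃ q ∈ Q, ∀ a ∈ U, S a q) ∧ U.ncard = n :=
        ⟨_, P, ⟨subset_rfl, hcom⟩, rfl⟩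
      obtain ⟨U, hU, hn⟩ := Nat.find_spec hex
      refine ⟨U, hU, fun W hW hlt => ?_⟩
      by_contra hno
      exact Nat.find_min hex (hn ▸ hlt) ⟨W, ⟨hW, hno⟩, rfl⟩
    intro a ha
    obtain ⟨u, hu⟩ : U.Nonempty := by
      rw [Set.nonempty_iff_ne_empty]
      rintro rfl
      obtain ⟨q, hq, -⟩ := hSS a ha a ha
      exact hUc ⟨q, hq, by simp⟩
    obtain ⟨v, hv, hvu⟩ : ∃ v ∈ U, v ≠ u := by
      by_contra! h
      obtain ⟨q, hq, h1, -⟩ := hSS u (hUP hu) u (hUP hu)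
      exact hUc ⟨q, hq, fun b hb => h b hb ▸ h1⟩
    obtain ⟨w, hw, hwu, hwv⟩ : ∃ w ∈ U, w ≠ u ∧ w ≠ v := by
      by_contra! h
      obtain ⟨q, hq, h1, h2⟩ := hSS u (hUP hu) v (hUP hv)
      refine hUc ⟨q, hq, fun b hb => ?_⟩
      by_cases hbu : b = u
      · exact hbu ▸ h1
      · exact h b hb hbu ▸ h2
    have hcard : ∀ x ∈ P, ∃ q ∈ Q, S x q ∧ ∀ z ∈ U \ {u, v}, S z q := by
      intro x hx
      have h2 : ({u, v} : Set V) ⊆ U := Set.insert_subset hu (Set.singleton_subset_iff.2 hv)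
      have h3 := Set.ncard_sdiff_add_ncard_of_subset h2
      rw [Set.ncard_pair hvu.symm] at h3
      have h4 := Set.ncard_insert_le x (U \ {u, v})
      obtain ⟨q, hq, h⟩ := hmin (insert x (U \ {u, v}))
        (Set.insert_subset hx (Set.sdiff_subset.trans hUP)) (by omega)
      exact ⟨q, hq, h x (Set.mem_insert _ _), fun z hz => h z (Set.mem_insert_of_mem _ hz)⟩
    -- Replacing u and v by a single element gives a smaller set, so w, which is among the fixed
    -- elements, is central in this relation; fullness at (u, v) gives U a common neighbour.
    have := center_eq hE hP hP hPfree hPfree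
      (R := fun x y => ∃ q ∈ Q, S x q ∧ S y q ∧ ∀ z ∈ U \ {u, v}, S z q) ?_ ?_ (hUP hw) ?_
      u (hUP hu) v (hUP hv)
    · obtain ⟨q, hq, h1, h2, h3⟩ := this
      refine (hUc ⟨q, hq, fun b hb => ?_⟩).elim
      by_cases hbu : b = u
      · exact hbu ▸ h1
      · by_cases hbv : b = v
        · exact hbv ▸ h2
        · exact h3 b ⟨hb, by simp [hbu, hbv]⟩
    · intro ι _ f hf x y h
      choose q hq h1 h2 h3 using h
      refine ⟨f q, hQ ι f hf q hq, hS ι f hf _ _ h1, hS ι f hf _ _ h2, fun z hz => ?_⟩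
      have := hS ι f hf (fun _ => z) q fun i => h3 i z hz
      rwa [hf.idem] at this
    · intro b hb
      obtain ⟨q, hq, h1, h2⟩ := hcard b hb
      exact ⟨b, hb, q, hq, h1, h1, h2⟩
    · intro b hb
      obtain ⟨q, hq, h1, h2⟩ := hcard b hb
      exact ⟨q, hq, h2 w ⟨hw, by simp [hwu, hwv]⟩, h1, h2⟩

/-- **Absorption theorem.** A linked subdirect relation between absorption-free subuniverses is
full. -/
theorem full_of_linked [Finite V] (hE : ¬ Projective E) {P Q : Set V} {R : V → V → Prop}
    (hP : IsSub E P) (hQ : IsSub E Q) (hPfree : AbsFree E P) (hQfree : AbsFree E Q)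
    (hR : IsSubRel E R) (hl : ∀ a ∈ P, ∃ q ∈ Q, R a q) (hr : ∀ q ∈ Q, ∃ a ∈ P, R a q)
    (hlink : ∀ a ∈ P, ∀ b ∈ P,
      Relation.ReflTransGen (fun x y => x ∈ P ∧ y ∈ P ∧ ∃ q ∈ Q, R x q ∧ R y q) a b) :
    ∀ a ∈ P, ∀ q ∈ Q, R a q := by
  refine full_of_comp_full hE hP hQ hPfree hQfree hR hr ?_
  by_contra hnot
  let L : Set (V × V) := {z | z.1 ∈ P ∧ z.2 ∈ P ∧ ∃ q ∈ Q, R z.1 q ∧ R z.2 q}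
  have hLsub : IsSubRel E fun x y => (x, y) ∈ L := by
    intro ι _ f hf x y h
    choose h1 h2 q hq h3 h4 using h
    exact ⟨hP ι f hf _ h1, hP ι f hf _ h2, f q, hQ ι f hf q hq, hR ι f hf _ _ h3,
      hR ι f hf _ _ h4⟩
  -- For a maximal such S, the composite S ∘ S is not full, by `full_of_comp_full`; hence it equals
  -- S, so S is transitive and linkedness makes it full.
  let Φ : Set (V × V) → Prop := fun S => L ⊆ S ∧ (IsSubRel E fun x y => (x, y) ∈ S) ∧
    (∀ x y, (x, y) ∈ S → x ∈ P ∧ y ∈ P ∧ (y, x) ∈ S) ∧ ¬ ∀ a ∈ P, ∀ b ∈ P, (a, b) ∈ S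
  obtain ⟨S, hS⟩ := exists_maximal_of_wellFoundedGT Φ ⟨L, subset_rfl, hLsub,
    fun x y ⟨h1, h2, q, hq, h3, h4⟩ => ⟨h1, h2, h2, h1, q, hq, h4, h3⟩,
    fun h => hnot fun a ha b hb => (h a ha b hb).2.2⟩
  obtain ⟨hLS, hSsub, hSsym, hSfull⟩ := hS.prop
  have hrefl : ∀ a ∈ P, (a, a) ∈ S := fun a ha => by
    obtain ⟨q, hq, h⟩ := hl a ha
    exact hLS ⟨ha, ha, q, hq, h, h⟩
  have hle : S ⊆ {z | ∃ m ∈ P, (z.1, m) ∈ S ∧ (z.2, m) ∈ S} := by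
    rintro ⟨x, y⟩ hxy
    have := hSsym _ _ hxy
    exact ⟨y, this.2.1, hxy, hrefl _ this.2.1⟩
  have hcomp : Φ {z | ∃ m ∈ P, (z.1, m) ∈ S ∧ (z.2, m) ∈ S} := by
    refine ⟨hLS.trans hle, ?_, ?_, ?_⟩
    · intro ι _ f hf x y h
      choose q hq h3 h4 using h
      exact ⟨f q, hP ι f hf q hq, hSsub ι f hf _ _ h3, hSsub ι f hf _ _ h4⟩
    · rintro x y ⟨m, hm, h1, h2⟩
      exact ⟨(hSsym _ _ h1).1, (hSsym _ _ h2).1, m, hm, h2, h1⟩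
    · intro h
      exact hSfull (full_of_comp_full hE hP hP hPfree hPfree hSsub
        (fun q hq => ⟨q, hq, hrefl q hq⟩) h)
  have heq := hS.le_of_ge hcomp hle
  have htrans : ∀ x y z, (x, y) ∈ S → (y, z) ∈ S → (x, z) ∈ S := fun x y z h1 h2 =>
    heq ⟨y, (hSsym _ _ h1).2.1, h1, (hSsym _ _ h2).2.2⟩
  refine hSfull fun a ha b hb => ?_
  have := hlink a ha b hb
  induction this with
  | refl => exact hrefl a ha
  | tail _ h ih => exact htrans _ _ _ (ih h.1) (hLS h)

end Polymorphisms

/-! ### Relations closed under polymorphisms are pp-definable -/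

theorem IsPP.exs {L : Language} {α : Type*} : ∀ {n : ℕ} {φ : L.BoundedFormula α n}, IsPP φ →
    IsPP φ.exs
  | 0, _, h => h
  | _ + 1, φ, h => IsPP.exs (φ := φ.ex) (IsPP.exists' h)

theorem IsPP.exists_forall {L : Language} {M : Type*} [L.Structure M] {α : Type*} {n : ℕ}
    (i₀ : Fin n) {β : Type*} [Finite β] (P : β → (α → M) → (Fin n → M) → Prop)
    (h : ∀ b, ∃ φ : L.BoundedFormula α n, IsPP φ ∧ ∀ x y, φ.Realize x y ↔ P b x y) :
    ∃ φ : L.BoundedFormula α n, IsPP φ ∧ ∀ x y, φ.Realize x y ↔ ∀ b, P b x y := by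
  classical
  have := Fintype.ofFinite β
  have key : ∀ S : Finset β, ∃ φ : L.BoundedFormula α n, IsPP φ ∧
      ∀ x y, φ.Realize x y ↔ ∀ b ∈ S, P b x y := by
    intro S
    induction S using Finset.induction_on with
    | empty =>
      -- The empty conjunction has to be a trivial equality, which is why a bound variable `i₀` is
      -- supplied.
      exact ⟨Language.Term.bdEqual (Language.Term.var (Sum.inr i₀)) (Language.Term.var (Sum.inr i₀)),
        IsPP.atomic (.equal _ _), fun x y => by simp [Language.BoundedFormula.realize_bdEqual]⟩
    | insert b S _ ih =>
      obtain ⟨φ, hφ, h1⟩ := ih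
      obtain ⟨ψ, hψ, h2⟩ := h b
      exact ⟨ψ ⊓ φ, hψ.conj hφ, fun x y => by simp [h1, h2]⟩
  simpa using key Finset.univ

/-- The formula asserts the existence of an idempotent polymorphism of arity S, its value table
being the quantified variables, that maps the list of all tuples of S to x. Projections provide
every member of S, and invariance excludes everything else. -/
theorem Digraph.ppDefinable_of_pol {V : Type u} [Finite V] [Nontrivial V] (A : Digraph V)
    {α : Type} [Finite α] (S : Set (α → V))
    (hS : ∀ (ι : Type u) [Finite ι] (f : (ι → V) → V), IsPol A.Adj f →
      ∀ x : ι → α → V, (∀ i, x i ∈ S) → (fun a => f fun i => x i a) ∈ S) :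
    letI := A.toStructure
    PPDefinable (Language.graph.sum (pointLanguage V)) S := by
  let := A.toStructure
  let L := Language.graph.sum (pointLanguage V)
  obtain ⟨n, ⟨e⟩⟩ := Finite.exists_equiv_fin (S → V)
  let i₀ : Fin n := e fun _ => Classical.arbitrary V
  let adj : L.Relations 2 := Sum.inl Language.graphRel.adj
  let pt : V → L.Relations 1 := fun a => Sum.inr (PointRel.point a)
  let bv : Fin n → L.Term (α ⊕ Fin n) := fun i => Language.Term.var (Sum.inr i)
  obtain ⟨φ₁, hφ₁, h₁⟩ := IsPP.exists_forall (L := L) (M := V) (α := α) i₀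
    (β := {p : (S → V) × (S → V) // ∀ s, A.Adj (p.1 s) (p.2 s)})
    (fun p _ y => A.Adj (y (e p.1.1)) (y (e p.1.2))) (fun p =>
      ⟨adj.boundedFormula ![bv (e p.1.1), bv (e p.1.2)], IsPP.atomic (.rel _ _), fun x y => by
        rw [Language.BoundedFormula.realize_rel]
        exact Iff.rfl⟩)
  obtain ⟨φ₂, hφ₂, h₂⟩ := IsPP.exists_forall (L := L) (M := V) (α := α) i₀ (β := V)
    (fun a _ y => y (e fun _ => a) = a) (fun a =>
      ⟨(pt a).boundedFormula ![bv (e fun _ => a)], IsPP.atomic (.rel _ _), fun x y => by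
        rw [Language.BoundedFormula.realize_rel]
        exact Iff.rfl⟩)
  obtain ⟨φ₃, hφ₃, h₃⟩ := IsPP.exists_forall (L := L) (M := V) (α := α) i₀ (β := α)
    (fun a x y => x a = y (e fun s => s.1 a)) (fun a =>
      ⟨Language.Term.bdEqual (Language.Term.var (Sum.inl a)) (bv (e fun s => s.1 a)),
        IsPP.atomic (.equal _ _), fun x y => by
        rw [Language.BoundedFormula.realize_bdEqual]
        exact Iff.rfl⟩)
  refine ⟨(φ₁ ⊓ (φ₂ ⊓ φ₃)).exs, (hφ₁.conj (hφ₂.conj hφ₃)).exs, fun x => ?_⟩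
  rw [Language.BoundedFormula.realize_exs]
  simp only [Language.BoundedFormula.realize_inf, h₁, h₂, h₃]
  constructor
  · intro hx
    refine ⟨fun i => e.symm i ⟨x, hx⟩, ?_, ?_, ?_⟩
    · rintro ⟨p, hp⟩
      simpa using hp ⟨x, hx⟩
    · simp
    · simp
  · rintro ⟨y, hy₁, hy₂, hy₃⟩
    have hf : IsPol A.Adj fun u : S → V => y (e u) :=
      ⟨hy₂, fun u v huv => hy₁ ⟨(u, v), huv⟩⟩
    obtain rfl : x = fun a => y (e fun s => s.1 a) := funext hy₃
    exact hS S _ hf (fun s => s.1) (fun s => s.2)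

/-! ### Projective digraphs interpret all finite structures -/

theorem Digraph.ppInterprets_of_projective {V : Type u} [Finite V] (A : Digraph V)
    (h : Projective A.Adj) (L : Language) (B : Type*) [Finite B] [L.Structure B] :
    A.PPInterpretsWithParams L B := by
  classical
  let := A.toStructure
  obtain ⟨C, D, hC, ⟨c, hcC, hcD⟩, ⟨d, hdC, hdD⟩, hproj⟩ := h
  have : Nontrivial V := ⟨c, d, fun h => hcD (h ▸ hdD)⟩
  obtain ⟨m, ⟨e⟩⟩ := Finite.exists_equiv_fin B
  -- One-hot codes; the spare last coordinate keeps the dimension positive even for empty B.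
  let code : B → Fin (m + 1) → Prop := fun b j => j = (e b).castSucc
  have hcode : ∀ b b', (∀ j, code b j ↔ code b' j) → b = b' := fun b b' h => by
    have := (h (e b).castSucc).1 rfl
    exact e.injective (Fin.castSucc_injective _ this)
  let h : (Fin (m + 1) → V) →. B := fun x =>
    ⟨∃ b, (∀ j, x j ∈ C) ∧ ∀ j, x j ∈ D ↔ code b j, fun H => H.choose⟩
  have hmem : ∀ x b, b ∈ h x ↔ (∀ j, x j ∈ C) ∧ ∀ j, x j ∈ D ↔ code b j := by
    intro x b
    constructor
    · rintro ⟨H, rfl⟩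
      exact H.choose_spec
    · intro hb
      have H : ∃ b, (∀ j, x j ∈ C) ∧ ∀ j, x j ∈ D ↔ code b j := ⟨b, hb⟩
      exact ⟨H, hcode _ _ fun j => (H.choose_spec.2 j).symm.trans (hb.2 j)⟩
  have key : ∀ (n : ℕ) (R : Set (Fin n → B)),
      PPDefinable (Language.graph.sum (pointLanguage V)) (relPreimage h R) := by
    intro n R
    refine A.ppDefinable_of_pol _ fun ι _ f hf x hx => ?_
    obtain ⟨i, hi⟩ := hproj ι f hf
    have hxC : ∀ k p, x k p ∈ C := fun k p => by
      obtain ⟨b, hb, hb'⟩ := hx k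
      exact ((hmem _ _).1 (hb' p.1)).1 p.2
    obtain ⟨b, hb, hb'⟩ := hx i
    refine ⟨b, hb, fun k => (hmem _ _).2 ⟨fun j => hC ι f hf _ fun k' => hxC _ _, fun j => ?_⟩⟩
    rw [hi _ fun k' => hxC k' (k, j)]
    exact ((hmem _ _).1 (hb' k)).2 j
  refine ⟨m + 1, by omega, h, fun b => ?_, key _ _, key _ _, fun n R => key _ _⟩
  refine ⟨fun j => if code b j then d else c, (hmem _ _).2 ⟨fun j => ?_, fun j => ?_⟩⟩
  · split_ifs <;> assumption
  · by_cases hj : code b j <;> simp [hj, hcD, hdD]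

/-! ### Conjugates of polymorphisms and twisted relations -/

section Twisted

variable {V : Type u} {E : V → V → Prop}

/-- The conjugate of an operation by a permutation. -/
def conjOp {ι : Type u} (h : Equiv.Perm V) (f : (ι → V) → V) : (ι → V) → V :=
  fun x => h⁻¹ (f fun i => h (x i))

theorem conjOp_one {ι : Type u} (f : (ι → V) → V) : conjOp 1 f = f := rfl

theorem conjOp_conjOp {ι : Type u} (a b : Equiv.Perm V) (f : (ι → V) → V) :
    conjOp a (conjOp b f) = conjOp (b * a) f := by
  funext x
  simp [conjOp]

theorem conjOp_star {ι κ : Type u} (a : Equiv.Perm V) (f : (ι → V) → V) (h : (κ → V) → V) :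
    conjOp a (starOp f h) = starOp (conjOp a f) (conjOp a h) := by
  funext x
  simp [conjOp, starOp]

/-- The group `G` consists of automorphisms of `E`. -/
def ActsOn (G : Subgroup (Equiv.Perm V)) (E : V → V → Prop) : Prop :=
  ∀ h ∈ G, ∀ a b, E (h a) (h b) ↔ E a b

variable {G : Subgroup (Equiv.Perm V)}

theorem IsPol.conj (hG : ActsOn G E) {h : Equiv.Perm V} (hh : h ∈ G) {ι : Type u}
    {f : (ι → V) → V} (hf : IsPol E f) : IsPol E (conjOp h f) where
  idem a := by simp [conjOp, hf.idem]
  pres x y hxy := by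
    rw [conjOp, conjOp, hG _ (G.inv_mem hh)]
    exact hf.pres _ _ fun i => (hG _ hh _ _).2 (hxy i)

/-- Relations preserved by every polymorphism on the left side and its conjugate on the right. -/
def IsTw (E : V → V → Prop) (h : Equiv.Perm V) (T : V → V → Prop) : Prop :=
  ∀ (ι : Type u) [Finite ι] (f : (ι → V) → V), IsPol E f →
    ∀ x y : ι → V, (∀ i, T (x i) (y i)) → T (f x) (conjOp h f y)

theorem IsTw.flip (hG : ActsOn G E) {h : Equiv.Perm V} (hh : h ∈ G) {T : V → V → Prop}
    (hT : IsTw E h T) : IsTw E h⁻¹ (flip T) := by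
  intro ι _ f hf x y hxy
  have := hT ι _ (hf.conj hG (G.inv_mem hh)) y x hxy
  rwa [conjOp_conjOp, inv_mul_cancel, conjOp_one] at this

/-- Walks of a given length. -/
def Steps (T : V → V → Prop) : ℕ → V → V → Prop
  | 0, x, y => x = y
  | k + 1, x, z => ∃ y, T x y ∧ Steps T k y z

theorem Steps.add {T : V → V → Prop} {m n : ℕ} : ∀ {x y z : V}, Steps T m x y → Steps T n y z →
    Steps T (m + n) x z := by
  induction m with
  | zero =>
    rintro x y z rfl h
    rwa [Nat.zero_add]
  | succ m ih =>
    rintro x y z ⟨w, hw, h⟩ h'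
    rw [Nat.add_right_comm]
    exact ⟨w, hw, ih h h'⟩

theorem Steps.one {T : V → V → Prop} {x y : V} (h : T x y) : Steps T 1 x y := ⟨y, h, rfl⟩

theorem Steps.flip {T : V → V → Prop} {k : ℕ} : ∀ {x y : V}, Steps T k x y →
    Steps (flip T) k y x := by
  induction k with
  | zero => exact fun h => Eq.symm h
  | succ k ih =>
    rintro x y ⟨w, hw, h⟩
    exact (ih h).add (Steps.one hw)

theorem Steps.exists_right {T : V → V → Prop} {B : Set V}
    (h : ∀ x ∈ B, ∃ y ∈ B, T x y) (k : ℕ) : ∀ x ∈ B, ∃ y ∈ B, Steps T k x y := by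
  induction k with
  | zero => exact fun x hx => ⟨x, hx, rfl⟩
  | succ k ih =>
    intro x hx
    obtain ⟨y, hy, hxy⟩ := h x hx
    obtain ⟨z, hz, hyz⟩ := ih y hy
    exact ⟨z, hz, y, hxy, hyz⟩

theorem Steps.exists_left {T : V → V → Prop} {B : Set V}
    (h : ∀ x ∈ B, ∃ y ∈ B, T y x) (k : ℕ) : ∀ x ∈ B, ∃ y ∈ B, Steps T k y x := by
  intro x hx
  obtain ⟨y, hy, hyx⟩ := Steps.exists_right (T := Function.swap T) h k x hx
  exact ⟨y, hy, hyx.flip⟩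

/-- Each step adds one conjugation by h to the operation used at the next vertex. -/
theorem IsTw.steps (hG : ActsOn G E) {h : Equiv.Perm V} (hh : h ∈ G) {T : V → V → Prop}
    (hT : IsTw E h T) (k : ℕ) : IsTw E (h ^ k) (Steps T k) := by
  induction k with
  | zero =>
    intro ι _ f hf x y hxy
    obtain rfl : x = y := funext hxy
    rfl
  | succ k ih =>
    intro ι _ f hf x y hxy
    choose z hz hzy using hxy
    refine ⟨_, hT ι f hf x z hz, ?_⟩
    have := ih ι _ (hf.conj hG hh) z y hzy
    rwa [conjOp_conjOp, ← pow_succ'] at this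

/-- Two vertices with a common out-neighbour at distance `k`. -/
def Link (T : V → V → Prop) (k : ℕ) (x y : V) : Prop :=
  ∃ z, Steps T k x z ∧ Steps T k y z

/-- Both ends of a link sit on the untwisted side; only the common target sees the conjugate. -/
theorem IsTw.link {h : Equiv.Perm V} {T : V → V → Prop} {k : ℕ}
    (hT : IsTw E h (Steps T k)) : IsSubRel E (Link T k) := by
  intro ι _ f hf x y hxy
  choose z hx hy using hxy
  exact ⟨_, hT ι f hf x z hx, hT ι f hf y z hy⟩

/-- The set of out-neighbours of `X`. -/
def img (T : V → V → Prop) (X : Set V) : Set V := {y | ∃ x ∈ X, T x y}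

theorem IsTw.isSub_img (hG : ActsOn G E) {h : Equiv.Perm V} (hh : h ∈ G) {T : V → V → Prop}
    (hT : IsTw E h T) {X : Set V} (hX : IsSub E X) : IsSub E (img T X) := by
  intro ι _ f hf y hy
  choose x hx hxy using hy
  have hf' := hf.conj hG (G.inv_mem hh)
  have := hT ι _ hf' x y hxy
  rw [conjOp_conjOp, inv_mul_cancel, conjOp_one] at this
  exact ⟨_, hX ι _ hf' x hx, this⟩

theorem IsSub.inter {X Y : Set V} (hX : IsSub E X) (hY : IsSub E Y) : IsSub E (X ∩ Y) :=
  fun ι _ f hf x hx => ⟨hX ι f hf x fun i => (hx i).1, hY ι f hf x fun i => (hx i).2⟩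

theorem mem_iterate_img {T : V → V → Prop} {X : Set V} {k : ℕ} {y : V} :
    y ∈ (img T)^[k] X ↔ ∃ x ∈ X, Steps T k x y := by
  induction k generalizing X with
  | zero => simp [Steps]
  | succ k ih =>
    rw [Function.iterate_succ_apply, ih]
    constructor
    · rintro ⟨z, ⟨x, hx, hxz⟩, hzy⟩
      exact ⟨x, hx, z, hxz, hzy⟩
    · rintro ⟨x, hx, z, hxz, hzy⟩
      exact ⟨z, ⟨x, hx, hxz⟩, hzy⟩

/-- If changing one coordinate along `L` changes the value of `f` along `M`, then changing all
coordinates along chains of `L` changes the value along a chain of `M`. -/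
theorem reflTransGen_of_coordinates {ι : Type*} [Finite ι] {L M : V → V → Prop}
    [DecidableEq ι] (f : (ι → V) → V) (x y : ι → V)
    (H : ∀ i z u v, (∀ j, j ≠ i → z j = x j ∨ z j = y j) → L u v →
      M (f (Function.update z i u)) (f (Function.update z i v)))
    (hxy : ∀ i, Relation.ReflTransGen L (x i) (y i)) : Relation.ReflTransGen M (f x) (f y) := by
  have := Fintype.ofFinite ι
  have key : ∀ S : Finset ι,
      Relation.ReflTransGen M (f x) (f fun j => if j ∈ S then y j else x j) := by
    intro S
    induction S using Finset.induction_on with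
    | empty => simpa using Relation.ReflTransGen.refl
    | insert i S hi ih =>
      refine ih.trans ?_
      let z : ι → V := fun j => if j ∈ S then y j else x j
      have h1 : (fun j => if j ∈ S then y j else x j) = Function.update z i (x i) := by
        funext j
        by_cases hj : j = i
        · subst hj
          simp [hi]
        · simp [hj, z]
      have h2 : (fun j => if j ∈ insert i S then y j else x j) = Function.update z i (y i) := by
        funext j
        by_cases hj : j = i
        · subst hj
          simp
        · simp [hj, z]
      rw [h1, h2]
      refine (hxy i).lift (fun u => f (Function.update z i u)) fun u v huv => H i z u v ?_ huv
      intro j _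
      by_cases hj : j ∈ S <;> simp [z, hj]
  simpa using key Finset.univ

/-- A smooth twisted digraph on a subuniverse. -/
structure TwistedOn (E : V → V → Prop) (G : Subgroup (Equiv.Perm V)) (B : Set V)
    (h : Equiv.Perm V) (T : V → V → Prop) : Prop where
  mem : h ∈ G
  sub : IsSub E B
  tw : IsTw E h T
  left : ∀ {x y}, T x y → x ∈ B
  right : ∀ {x y}, T x y → y ∈ B
  succ : ∀ x ∈ B, ∃ y ∈ B, T x y
  pred : ∀ y ∈ B, ∃ x ∈ B, T x y

theorem TwistedOn.flip (hG : ActsOn G E) {B : Set V} {h : Equiv.Perm V} {T : V → V → Prop}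
    (H : TwistedOn E G B h T) : TwistedOn E G B h⁻¹ (flip T) where
  mem := G.inv_mem H.mem
  sub := H.sub
  tw := H.tw.flip hG H.mem
  left h := H.right h
  right h := H.left h
  succ := H.pred
  pred := H.succ

/-! ### Reduction to absorbing subuniverses -/

/-- `X` is a nonempty subuniverse of `B` absorbing it by all conjugates of `f`. -/
structure AbsorbsAll (E : V → V → Prop) (G : Subgroup (Equiv.Perm V)) {ι : Type u}
    (f : (ι → V) → V) (X B : Set V) : Prop where
  subset : X ⊆ B
  nonempty : X.Nonempty
  sub : IsSub E X
  absorbs : ∀ h ∈ G, PolAbsorbs (conjOp h f) X B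

/-- A star composition absorbs as soon as one factor does. Including the conjugate of f by each
inverse a⁻¹ ensures that conjugating by a restores f in one factor. -/
theorem exists_absorbsAll [Finite V] (hG : ActsOn G E) {X B : Set V} (hXB : X ⊆ B)
    (hX : IsSub E X) (hB : IsSub E B) (hne : X.Nonempty) {ι : Type u} [Finite ι]
    {f : (ι → V) → V} (hf : IsPol E f) (habs : PolAbsorbs f X B) :
    ∃ (κ : Type u) (_ : Finite κ) (F : (κ → V) → V), IsPol E F ∧ AbsorbsAll E G F X B := by
  classical
  have key : ∀ S : Finset G, ∃ (κ : Type u) (_ : Finite κ) (F : (κ → V) → V), IsPol E F ∧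
      ∀ h ∈ S, PolAbsorbs (conjOp h.1 F) X B := by
    intro S
    induction S using Finset.induction_on with
    | empty => exact ⟨ι, inferInstance, f, hf, by simp⟩
    | insert a S _ ih =>
      obtain ⟨κ, _, F, hF, h⟩ := ih
      have hf' := hf.conj hG (G.inv_mem a.2)
      refine ⟨κ × ι, inferInstance, starOp F (conjOp a.1⁻¹ f), hF.star hf', fun b hb => ?_⟩
      rw [conjOp_star]
      rcases Finset.mem_insert.1 hb with rfl | hb
      · refine PolAbsorbs.star_right hX hXB (hF.conj hG b.2) ?_
        rwa [conjOp_conjOp, inv_mul_cancel, conjOp_one]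
      · exact (h b hb).star_left hX hB hXB (hf'.conj hG b.2)
  have := Fintype.ofFinite G
  obtain ⟨κ, hκ, F, hF, h⟩ := key Finset.univ
  exact ⟨κ, hκ, F, hF, hXB, hne, hX, fun a ha => h ⟨a, ha⟩ (Finset.mem_univ _)⟩

variable {ι : Type u} {f : (ι → V) → V} {B : Set V} {h : Equiv.Perm V}
  {T : V → V → Prop}

/-- Passing to predecessors replaces the conjugate by a with the one by a h⁻¹, so absorption by all
conjugates is what survives taking images. -/
theorem AbsorbsAll.img [Finite ι] (hG : ActsOn G E) (hf : IsPol E f) (H : TwistedOn E G B h T) {X : Set V}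
    (hX : AbsorbsAll E G f X B) : AbsorbsAll E G f (img T X) B where
  subset := fun _ ⟨_, _, h⟩ => H.right h
  nonempty := by
    obtain ⟨x, hx⟩ := hX.nonempty
    obtain ⟨y, -, hy⟩ := H.succ x (hX.subset hx)
    exact ⟨y, x, hx, hy⟩
  sub := H.tw.isSub_img hG H.mem hX.sub
  absorbs := by
    intro a ha y i hy hi
    have hx : ∀ j, ∃ x ∈ B, T x (y j) ∧ (j ≠ i → x ∈ X) := by
      intro j
      by_cases hj : j = i
      · subst hj
        obtain ⟨x, hx, hxy⟩ := H.pred _ hi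
        exact ⟨x, hx, hxy, fun h => (h rfl).elim⟩
      · obtain ⟨x, hx, hxy⟩ := hy j hj
        exact ⟨x, hX.subset hx, hxy, fun _ => hx⟩
    choose x hxB hxy hxX using hx
    have hmem := G.mul_mem ha (G.inv_mem H.mem)
    have := H.tw ι _ (hf.conj hG hmem) x y hxy
    rw [conjOp_conjOp, inv_mul_cancel_right] at this
    exact ⟨_, hX.absorbs _ hmem x i hxX (hxB i), this⟩

theorem AbsorbsAll.inter {X Y : Set V} (hX : AbsorbsAll E G f X B) (hY : AbsorbsAll E G f Y B)
    (hne : (X ∩ Y).Nonempty) : AbsorbsAll E G f (X ∩ Y) B where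
  subset := Set.inter_subset_left.trans hX.subset
  nonempty := hne
  sub := hX.sub.inter hY.sub
  absorbs a ha x i hx hi :=
    ⟨hX.absorbs a ha x i (fun j hj => (hx j hj).1) hi,
      hY.absorbs a ha x i (fun j hj => (hx j hj).2) hi⟩

/-- If images and preimages of proper absorbing sets stayed proper, going k steps forward and k back
from a maximal one would return the same set. It would be closed under links, hence all of B. -/
theorem AbsorbsAll.exists_img_eq [Finite V] [Finite ι] (hG : ActsOn G E) (hf : IsPol E f)
    (H : TwistedOn E G B h T) {X : Set V} (hX : AbsorbsAll E G f X B) (hXB : X ≠ B) {k : ℕ}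
    (hlink : ∀ c ∈ B, ∀ d ∈ B, Relation.ReflTransGen (Link T k) c d) :
    ∃ Y, AbsorbsAll E G f Y B ∧ Y ≠ B ∧ (_root_.img T Y = B ∨ _root_.img (flip T) Y = B) := by
  by_contra! hcon
  let Φ : Set V → Prop := fun Y => AbsorbsAll E G f Y B ∧ Y ≠ B
  obtain ⟨Y, hY⟩ := exists_maximal_of_wellFoundedGT Φ ⟨X, hX, hXB⟩
  have h1 : ∀ n, ∀ Z, Φ Z → Φ ((_root_.img T)^[n] Z) := fun n Z hZ =>
    Function.Iterate.rec Φ hZ (fun Z hZ => ⟨hZ.1.img hG hf H, (hcon Z hZ.1 hZ.2).1⟩) n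
  have h2 : ∀ n, ∀ Z, Φ Z → Φ ((_root_.img (flip T))^[n] Z) := fun n Z hZ =>
    Function.Iterate.rec Φ hZ
      (fun Z hZ => ⟨hZ.1.img hG hf (H.flip hG), (hcon Z hZ.1 hZ.2).2⟩) n
  have hsub : Y ⊆ (_root_.img (flip T))^[k] ((_root_.img T)^[k] Y) := by
    intro y hy
    obtain ⟨z, -, hz⟩ := Steps.exists_right H.succ k y (hY.prop.1.subset hy)
    exact mem_iterate_img.2 ⟨z, mem_iterate_img.2 ⟨y, hy, hz⟩, hz.flip⟩
  have heq := hY.le_of_ge (h2 k _ (h1 k _ hY.prop)) hsub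
  refine hY.prop.2 (hY.prop.1.subset.antisymm fun d hd => ?_)
  obtain ⟨c, hc⟩ := hY.prop.1.nonempty
  have := hlink c (hY.prop.1.subset hc) d hd
  clear hd
  induction this with
  | refl => exact hc
  | tail _ hl ih =>
    obtain ⟨z, hz, hz'⟩ := hl
    exact heq (mem_iterate_img.2 ⟨z, mem_iterate_img.2 ⟨_, ih, hz⟩, hz'.flip⟩)

/-- In a minimal absorbing set with internal predecessors, discarding vertices without an internal
successor keeps those predecessors, so by minimality nothing is discarded. -/
theorem AbsorbsAll.exists_smooth_of_img_eq [Finite V] [Finite ι] (hG : ActsOn G E) (hf : IsPol E f)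
    (H : TwistedOn E G B h T) {X : Set V} (hX : AbsorbsAll E G f X B) (hXB : X ≠ B)
    (himg : _root_.img T X = B) :
    ∃ Y, AbsorbsAll E G f Y B ∧ Y ≠ B ∧ (∀ x ∈ Y, ∃ y ∈ Y, T x y) ∧ ∀ y ∈ Y, ∃ x ∈ Y, T x y := by
  obtain ⟨Y, hY⟩ := exists_minimal_of_wellFoundedLT
    (fun Y => AbsorbsAll E G f Y B ∧ Y ≠ B ∧ ∀ y ∈ Y, ∃ x ∈ Y, T x y)
    ⟨X, hX, hXB, fun y hy => himg.ge (hX.subset hy)⟩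
  obtain ⟨hYabs, hYB, hYpred⟩ := hY.prop
  have hle := hY.le_of_le (y := Y ∩ _root_.img (flip T) Y) ⟨?_, ?_, ?_⟩ Set.inter_subset_left
  · exact ⟨Y, hYabs, hYB, fun x hx => (hle hx).2, hYpred⟩
  · refine hYabs.inter (hYabs.img hG hf (H.flip hG)) ?_
    obtain ⟨y, hy⟩ := hYabs.nonempty
    obtain ⟨x, hx, hxy⟩ := hYpred y hy
    exact ⟨x, hx, y, hy, hxy⟩
  · exact fun h => hYB (hYabs.subset.antisymm (h.ge.trans Set.inter_subset_left))
  · rintro y ⟨hy, -⟩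
    obtain ⟨x, hx, hxy⟩ := hYpred y hy
    exact ⟨x, ⟨hx, y, hy, hxy⟩, hxy⟩

theorem AbsorbsAll.exists_smooth [Finite V] [Finite ι] (hG : ActsOn G E) (hf : IsPol E f)
    (H : TwistedOn E G B h T) {X : Set V} (hX : AbsorbsAll E G f X B) (hXB : X ≠ B) {k : ℕ}
    (hlink : ∀ c ∈ B, ∀ d ∈ B, Relation.ReflTransGen (Link T k) c d) :
    ∃ Y, AbsorbsAll E G f Y B ∧ Y ≠ B ∧ (∀ x ∈ Y, ∃ y ∈ Y, T x y) ∧ ∀ y ∈ Y, ∃ x ∈ Y, T x y := by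
  obtain ⟨Y, hY, hYB, himg | himg⟩ := hX.exists_img_eq hG hf H hXB hlink
  · exact hY.exists_smooth_of_img_eq hG hf H hYB himg
  · obtain ⟨Z, h1, h2, h3, h4⟩ := hY.exists_smooth_of_img_eq hG hf (H.flip hG) hYB himg
    exact ⟨Z, h1, h2, h4, h3⟩

/-! ### The twisted digraph on a subuniverse -/

/-- The digraph on `B` with edges from `x` to `y` whenever `E x (g y)`. -/
def twist (E : V → V → Prop) (B : Set V) (g : Equiv.Perm V) (x y : V) : Prop :=
  x ∈ B ∧ y ∈ B ∧ E x (g y)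

/-- A nonempty subuniverse on which the twisted digraph is smooth and linked. -/
structure GoodPair (E : V → V → Prop) (G : Subgroup (Equiv.Perm V)) (B : Set V)
    (g : Equiv.Perm V) : Prop where
  mem : g ∈ G
  sub : IsSub E B
  nonempty : B.Nonempty
  succ : ∀ x ∈ B, ∃ y ∈ B, E x (g y)
  pred : ∀ y ∈ B, ∃ x ∈ B, E x (g y)
  link : ∃ k, ∀ c ∈ B, ∀ d ∈ B, Relation.ReflTransGen (Link (twist E B g) (k + 1)) c d

variable {g : Equiv.Perm V}

theorem GoodPair.twistedOn (hG : ActsOn G E) (H : GoodPair E G B g) :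
    TwistedOn E G B g (twist E B g) where
  mem := H.mem
  sub := H.sub
  tw := by
    intro ι _ f hf x y hxy
    refine ⟨H.sub ι f hf x fun i => (hxy i).1,
      H.sub ι _ (hf.conj hG H.mem) y fun i => (hxy i).2.1, ?_⟩
    simpa [conjOp] using hf.pres _ _ fun i => (hxy i).2.2
  left h := h.1
  right h := h.2.1
  succ x hx := by
    obtain ⟨y, hy, hxy⟩ := H.succ x hx
    exact ⟨y, hy, hx, hy, hxy⟩
  pred y hy := by
    obtain ⟨x, hx, hxy⟩ := H.pred y hy
    exact ⟨x, hx, hx, hy, hxy⟩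

/-- Walks are combined vertex by vertex, with the conjugate by a g^m at position m; each conjugate
absorbs the one coordinate that runs through B. -/
theorem AbsorbsAll.steps [DecidableEq ι] (hG : ActsOn G E) (hf : IsPol E f) (hg : g ∈ G)
    {X : Set V} (hX : AbsorbsAll E G f X B) (i : ι) (k : ℕ) :
    ∀ a ∈ G, ∀ x y : ι → V, (∀ j, Steps (twist E (if j = i then B else X) g) k (x j) (y j)) →
      Steps (twist E X g) k (conjOp a f x) (conjOp (a * g ^ k) f y) := by
  induction k with
  | zero =>
    intro a ha x y hxy
    obtain rfl : x = y := funext hxy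
    simp [Steps]
  | succ k ih =>
    intro a ha x y hxy
    choose m hxm hmy using hxy
    have hag := G.mul_mem ha hg
    have key : ∀ b ∈ G, ∀ z : ι → V, (∀ j, z j ∈ if j = i then B else X) →
        conjOp b f z ∈ X := fun b hb z hz =>
      hX.absorbs b hb z i (fun j hj => by simpa [hj] using hz j) (by simpa using hz i)
    refine ⟨conjOp (a * g) f m, ⟨key a ha x fun j => (hxm j).1,
      key _ hag m fun j => (hxm j).2.1, ?_⟩, ?_⟩
    · have := (hf.conj hG ha).pres _ _ fun j => (hxm j).2.2
      simpa [conjOp] using this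
    · have := ih (a * g) hag m y hmy
      rwa [mul_assoc, ← pow_succ'] at this

/-- Linkedness passes to a smooth absorbing Y by moving the arguments of F from c to d one at a
time: a link in B at one coordinate, with walks inside Y at the others, is absorbed into a link in
Y. -/
theorem GoodPair.exists_ssubset_of_absorbing [Finite V] [Finite ι] (hG : ActsOn G E)
    (H : GoodPair E G B g)
    {X : Set V} (hXB : X ⊆ B) (hne : X.Nonempty) (hX : IsSub E X) (hf : IsPol E f)
    (habs : PolAbsorbs f X B) (hXB' : X ≠ B) : ∃ Y ⊂ B, GoodPair E G Y g := by
  classical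
  obtain ⟨κ, _, F, hF, hFX⟩ := exists_absorbsAll hG hXB hX H.sub hne hf habs
  obtain ⟨k, hk⟩ := H.link
  obtain ⟨Y, hY, hYB, hsucc, hpred⟩ := hFX.exists_smooth hG hF (H.twistedOn hG) hXB' hk
  refine ⟨Y, hY.subset.ssubset_of_ne hYB, H.mem, hY.sub, hY.nonempty, fun x hx => ?_,
    fun y hy => ?_, k, fun c hc d hd => ?_⟩
  · obtain ⟨y, hy, hxy⟩ := hsucc x hx
    exact ⟨y, hy, hxy.2.2⟩
  · obtain ⟨x, hx, hxy⟩ := hpred y hy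
    exact ⟨x, hx, hxy.2.2⟩
  · have := reflTransGen_of_coordinates (L := Link (twist E B g) (k + 1))
      (M := Link (twist E Y g) (k + 1)) F (fun _ => c) (fun _ => d) ?_
      fun _ => hk c (hY.subset hc) d (hY.subset hd)
    · rwa [hF.idem, hF.idem] at this
    · rintro i z u v hz ⟨w, hu, hv⟩
      have hs : ∀ j, ∃ s, j ≠ i → Steps (twist E Y g) (k + 1) (z j) s := by
        intro j
        by_cases hj : j = i
        · exact ⟨z j, fun h => (h hj).elim⟩
        · have hzY : z j ∈ Y := by
            rcases hz j hj with h | h <;> rw [h] <;> assumption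
          obtain ⟨s, -, hs⟩ := Steps.exists_right (T := twist E Y g)
            (fun x hx => by
              obtain ⟨y, hy, hxy⟩ := hsucc x hx
              exact ⟨y, hy, hx, hy, hxy.2.2⟩) (k + 1) _ hzY
          exact ⟨s, fun _ => hs⟩
      choose s hs using hs
      have key : ∀ t, Steps (twist E B g) (k + 1) t w →
          Steps (twist E Y g) (k + 1) (F (Function.update z i t))
            (conjOp (1 * g ^ (k + 1)) F (Function.update s i w)) := by
        intro t ht
        refine hY.steps hG hF H.mem i (k + 1) 1 G.one_mem
          (Function.update z i t) (Function.update s i w) fun j => ?_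
        by_cases hj : j = i
        · subst hj
          simpa using ht
        · simpa [hj] using hs j hj
      exact ⟨_, key u hu, key v hv⟩

end Twisted

/-! ### Loops in linked twisted digraphs -/

section LoopLemma

variable {V : Type u} {E : V → V → Prop} {G : Subgroup (Equiv.Perm V)} {B : Set V}
  {g : Equiv.Perm V}

theorem Steps.left_mem {T : V → V → Prop} (hT : ∀ {x y}, T x y → x ∈ B) {k : ℕ} {x y : V}
    (h : Steps T (k + 1) x y) : x ∈ B := by
  obtain ⟨z, hz, -⟩ := h
  exact hT hz

theorem Steps.right_mem {T : V → V → Prop} (hT : ∀ {x y}, T x y → y ∈ B) {k : ℕ} {x y : V}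
    (h : Steps T (k + 1) x y) : y ∈ B :=
  Steps.left_mem (T := _root_.flip T) (fun h => hT h) h.flip

/-- The absorption theorem for a twisted relation. -/
theorem TwistedOn.full_of_linked [Finite V] (hE : ¬ Projective E) (hG : ActsOn G E)
    {h : Equiv.Perm V} {R : V → V → Prop} (H : TwistedOn E G B h R) (hfree : AbsFree E B)
    (hlink : ∀ a ∈ B, ∀ b ∈ B, Relation.ReflTransGen (fun x y => ∃ q, R x q ∧ R y q) a b) :
    ∀ a ∈ B, ∀ b ∈ B, R a b := by
  -- Moving the right-hand side from B to h B untwists R into an ordinary invariant relation;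
  -- absorption freeness is carried along by conjugation.
  have hQ : IsSub E {y | h⁻¹ y ∈ B} := by
    intro ι _ f hf x hx
    have := H.sub ι _ (hf.conj hG H.mem) _ hx
    simpa [conjOp] using this
  have hQfree : AbsFree E {y | h⁻¹ y ∈ B} := by
    intro X hXQ hne hX ι _ f hf habs
    have hX' : IsSub E {x | h x ∈ X} := by
      intro κ _ p hp x hx
      have := hX κ _ (hp.conj hG (G.inv_mem H.mem)) _ hx
      simpa [conjOp] using this
    have := hfree {x | h x ∈ X} (fun x hx => by simpa using hXQ hx) ?_ hX' ι _
      (hf.conj hG H.mem) ?_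
    · refine hXQ.antisymm fun y hy => ?_
      have hy' : h⁻¹ y ∈ B := hy
      rw [← this] at hy'
      simpa using hy'
    · obtain ⟨x, hx⟩ := hne
      exact ⟨h⁻¹ x, by simpa using hx⟩
    · intro x i hx hi
      have := habs (fun i => h (x i)) i hx (by simpa using hi)
      simpa [conjOp] using this
  have hR : IsSubRel E fun x y => R x (h⁻¹ y) := by
    intro ι _ f hf x y hxy
    have := H.tw ι f hf _ _ hxy
    simpa [conjOp] using this
  have := _root_.full_of_linked hE H.sub hQ hfree hQfree hR
    (fun a ha => by
      obtain ⟨y, hy, hay⟩ := H.succ a ha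
      exact ⟨h y, by simpa using hy, by simpa using hay⟩)
    (fun q hq => H.pred _ hq)
    (fun a ha b hb => Relation.ReflTransGen.mono (fun x y ⟨q, hx, hy⟩ =>
      ⟨H.left hx, H.left hy, h q, by simpa using H.right hx, by simpa using hx, by simpa using hy⟩) _ _ (hlink a ha b hb))
  intro a ha b hb
  simpa using this a ha (h b) (by simpa using hb)

theorem TwistedOn.steps (hG : ActsOn G E) {h : Equiv.Perm V} {T : V → V → Prop}
    (H : TwistedOn E G B h T) (k : ℕ) : TwistedOn E G B (h ^ (k + 1)) (Steps T (k + 1)) where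
  mem := G.pow_mem H.mem _
  sub := H.sub
  tw := H.tw.steps hG H.mem _
  left h := h.left_mem H.left
  right h := h.right_mem H.right
  succ := Steps.exists_right H.succ _
  pred := Steps.exists_left H.pred _

/-- If walks of length `n + 1` join any two vertices of an absorption-free twisted digraph, but
walks of length `n` do not link it, then it has a smaller good subuniverse. -/
theorem GoodPair.exists_ssubset_of_full_steps [Finite V] (hG : ActsOn G E)
    (H : GoodPair E G B g) {n : ℕ} (hn : 1 ≤ n)
    (hfull : ∀ a ∈ B, ∀ b ∈ B, Steps (twist E B g) (n + 1) a b)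
    (hnot : ¬ ∀ a ∈ B, ∀ b ∈ B, Relation.ReflTransGen (Link (twist E B g) n) a b) :
    ∃ C ⊂ B, GoodPair E G C g := by
  classical
  push Not at hnot
  obtain ⟨c, hc, c', hc', hcc'⟩ := hnot
  have HT := H.twistedOn hG
  set T := twist E B g with hT
  obtain ⟨m, rfl⟩ : ∃ m, n = m + 1 := ⟨n - 1, by omega⟩
  let D : Set V := {x | Relation.ReflTransGen (Link T (m + 1)) c x}
  have hcD : c ∈ D := Relation.ReflTransGen.refl
  have hDB : D ⊆ B := by
    intro x hx
    induction hx with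
    | refl => exact hc
    | tail _ h _ =>
      obtain ⟨z, -, h⟩ := h
      exact h.left_mem HT.left
  have hD : IsSub E D := by
    intro ι _ f hf x hx
    have := reflTransGen_of_coordinates (L := Link T (m + 1)) (M := Link T (m + 1)) f
      (fun _ => c) x ?_ hx
    · rwa [hf.idem] at this
    · intro i z u v hz huv
      refine (HT.tw.steps hG HT.mem (m + 1)).link ι f hf _ _ fun j => ?_
      by_cases hj : j = i
      · subst hj
        simpa using huv
      · have hzB : z j ∈ B := by
          rcases hz j hj with h | h <;> rw [h]
          exacts [hc, hDB (hx j)]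
        obtain ⟨s, -, hs⟩ := Steps.exists_right HT.succ (m + 1) _ hzB
        simpa [hj] using ⟨s, hs, hs⟩
  have hDlink : ∀ {d x w}, d ∈ D → Steps T (m + 1) d w → Steps T (m + 1) x w → x ∈ D :=
    fun hd h1 h2 => Relation.ReflTransGen.tail hd ⟨_, h1, h2⟩
  -- Prolonging both walks into y to length m + 1 links the start of any length-i walk into x with
  -- an element of D.
  have hback : ∀ {x y i k}, i + k ≤ m + 1 → x ∈ B → y ∈ B → Steps T k x y →
      y ∈ img (Steps T (i + k)) D → x ∈ img (Steps T i) D := by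
    rintro x y i k hik hx hy hxy ⟨d, hd, hdy⟩
    obtain ⟨x₀, hx₀, hx₀x⟩ := Steps.exists_left HT.pred i x hx
    obtain ⟨w, -, hyw⟩ := Steps.exists_right HT.succ (m + 1 - (i + k)) y hy
    have h1 := hdy.add hyw
    have h2 := (hx₀x.add hxy).add hyw
    rw [Nat.add_sub_cancel' hik] at h1 h2
    exact ⟨x₀, hDlink hd h1 h2, hx₀x⟩
  let C : Set V := {x | ∀ i ≤ m + 1, x ∈ img (Steps T i) D}
  have hCD : C ⊆ D := fun x hx => by
    obtain ⟨d, hd, rfl⟩ := hx 0 (by omega)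
    exact hd
  have hCsub : IsSub E C := fun ι _ f hf x hx i hi =>
    (HT.tw.steps hG HT.mem i).isSub_img hG (G.pow_mem HT.mem i) hD ι f hf x fun j => hx j i hi
  -- A full walk of length m + 2 from b to a vertex w at distance m + 1 from c has its second vertex
  -- linked to c.
  have hstep : ∀ b ∈ B, ∃ b' ∈ D, T b b' := by
    intro b hb
    obtain ⟨w, hw, hcw⟩ := Steps.exists_right HT.succ (m + 1) c hc
    obtain ⟨b', hbb', hb'w⟩ := hfull b hb w hw
    exact ⟨b', hDlink hcD hcw hb'w, hbb'⟩
  have hCne : C.Nonempty := by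
    have : ∀ b : D, ∃ b' : D, T b b' := fun b => by
      obtain ⟨b', hb', h⟩ := hstep b (hDB b.2)
      exact ⟨⟨b', hb'⟩, h⟩
    choose s hs using this
    have hsteps : ∀ i, ∀ b : D, Steps T i b (s^[i] b) := by
      intro i
      induction i with
      | zero => exact fun b => rfl
      | succ i ih => exact fun b => ⟨_, hs b, ih (s b)⟩
    refine ⟨s^[m + 1] ⟨c, hcD⟩, fun i hi => ⟨s^[m + 1 - i] ⟨c, hcD⟩, Subtype.coe_prop _, ?_⟩⟩
    have := hsteps i (s^[m + 1 - i] ⟨c, hcD⟩)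
    rwa [← Function.iterate_add_apply, Nat.add_sub_cancel' hi] at this
  -- Walks of length m + 2 between vertices of C stay in C: levels i ≥ j come forward from x, and
  -- levels i < j come back from y, since then i + k ≤ m + 1.
  have hbetween : ∀ {x b y j k}, j + k = m + 2 → x ∈ C → y ∈ C → b ∈ B → Steps T j x b →
      Steps T k b y → b ∈ C := by
    intro x b y j k hjk hx hy hb hxb hby i hi
    by_cases hji : j ≤ i
    · obtain ⟨d, hd, hdx⟩ := hx (i - j) (by omega)
      have := hdx.add hxb
      rw [Nat.sub_add_cancel hji] at this
      exact ⟨d, hd, this⟩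
    · exact hback (by omega) hb (hDB (hCD hy)) hby (hy (i + k) (by omega))
  have hlift : ∀ {x y}, x ∈ C → y ∈ C → ∀ k j b, j + k = m + 2 → b ∈ C → Steps T j x b →
      Steps T k b y → Steps (twist E C g) k b y := by
    intro x y hx hy k
    induction k with
    | zero => exact fun _ _ _ _ _ h => h
    | succ k ih =>
      rintro j b hjk hb hxb ⟨b', hbb', hb'y⟩
      have hxb' := hxb.add (Steps.one hbb')
      have hb' : b' ∈ C := hbetween (by omega) hx hy (HT.right hbb') hxb' hb'y
      exact ⟨b', ⟨hb, hb', hbb'.2.2⟩, ih (j + 1) b' (by omega) hb' hxb' hb'y⟩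
  have hCfull : ∀ x ∈ C, ∀ y ∈ C, Steps (twist E C g) (m + 2) x y := fun x hx y hy =>
    hlift hx hy (m + 2) 0 x (by omega) hx rfl (hfull x (hDB (hCD hx)) y (hDB (hCD hy)))
  have hCB : C ⊂ B := by
    refine (hCD.trans hDB).ssubset_of_ne ?_
    rintro h
    exact hcc' (hCD (h.ge hc'))
  refine ⟨C, hCB, H.mem, hCsub, hCne, fun x hx => ?_, fun y hy => ?_, m + 1,
    fun a ha b hb => .single ⟨b, hCfull a ha b hb, hCfull b hb b hb⟩⟩
  · obtain ⟨y, hxy, -⟩ := hCfull x hx x hx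
    exact ⟨y, hxy.2.1, hxy.2.2⟩
  · obtain ⟨x, hxy, -⟩ := (hCfull y hy y hy).flip
    exact ⟨x, hxy.1, hxy.2.2⟩

/-- Minimality of B excludes absorption, and minimality of the full walk length then forces that
length to be 1. -/
theorem GoodPair.exists_loop [Finite V] (hE : ¬ Projective E) (hG : ActsOn G E)
    (H : GoodPair E G B g) : ∃ x, E x (g x) := by
  obtain ⟨B, hB⟩ := exists_minimal_of_wellFoundedLT (fun B => GoodPair E G B g) ⟨B, H⟩
  clear H
  have H := hB.prop
  have hmin : ∀ C ⊂ B, ¬ GoodPair E G C g := fun C hC hgood => hC.2 (hB.le_of_le hgood hC.1)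
  have hfree : AbsFree E B := by
    intro X hXB hne hX ι _ f hf habs
    by_contra hXB'
    obtain ⟨Y, hY, hYgood⟩ := H.exists_ssubset_of_absorbing hG hXB hne hX hf habs hXB'
    exact hmin Y hY hYgood
  have hfull : ∀ k, (∀ a ∈ B, ∀ b ∈ B,
      Relation.ReflTransGen (Link (twist E B g) (k + 1)) a b) →
      ∀ a ∈ B, ∀ b ∈ B, Steps (twist E B g) (k + 1) a b := fun k hk =>
    ((H.twistedOn hG).steps hG k).full_of_linked hE hG hfree hk
  have hex : ∃ k, ∀ a ∈ B, ∀ b ∈ B, Steps (twist E B g) (k + 1) a b := by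
    obtain ⟨k, hk⟩ := H.link
    exact ⟨k, hfull k hk⟩
  classical
  have hspec := Nat.find_spec hex
  rcases hk : Nat.find hex with _ | k
  · rw [hk] at hspec
    obtain ⟨x, hx⟩ := H.nonempty
    obtain ⟨y, hxy, rfl⟩ := hspec x hx x hx
    exact ⟨_, hxy.2.2⟩
  · rw [hk] at hspec
    obtain ⟨C, hC, hCgood⟩ := H.exists_ssubset_of_full_steps hG (by omega) hspec fun h =>
      Nat.find_min hex (m := k) (by omega) (hfull k h)
    exact (hmin C hC hCgood).elim

/-! ### The initial subuniverse -/

theorem Link.mono_succ {T : V → V → Prop} (hT : ∀ x, ∃ y, T x y) {k : ℕ} {x y : V}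
    (h : Link T k x y) : Link T (k + 1) x y := by
  obtain ⟨z, hx, hy⟩ := h
  obtain ⟨w, hw⟩ := hT z
  exact ⟨w, hx.add (Steps.one hw), hy.add (Steps.one hw)⟩

theorem Link.reflTransGen_symm {T : V → V → Prop} {k : ℕ} {x y : V}
    (h : Relation.ReflTransGen (Link T k) x y) : Relation.ReflTransGen (Link T k) y x := by
  induction h with
  | refl => exact .refl
  | tail _ hl ih =>
    obtain ⟨z, h1, h2⟩ := hl
    exact .head ⟨z, h2, h1⟩ ih

/-- For a large length, the linkedness classes of a smooth digraph are permuted by the edges. -/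
theorem exists_linked_classes [Finite V] (hsucc : ∀ x, ∃ y, E x y) (hpred : ∀ y, ∃ x, E x y) :
    ∃ k, (∀ x y x' y', E x x' → E y y' → Relation.ReflTransGen (Link E (k + 1)) x' y' →
        Relation.ReflTransGen (Link E (k + 1)) x y) ∧
      (∀ x y x' y', E x x' → E y y' → Relation.ReflTransGen (Link E (k + 1)) x y →
        Relation.ReflTransGen (Link E (k + 1)) x' y') := by
  let θ : ℕ → V → V → Prop := fun k => Relation.ReflTransGen (Link E (k + 1))
  -- Linkedness grows with k, so by finiteness it stabilises; prefixing an edge to each link then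
  -- loses nothing.
  obtain ⟨S, ⟨k, rfl⟩, hS⟩ := exists_maximal_of_wellFoundedGT
    (fun S : Set (V × V) => ∃ k, S = {p | θ k p.1 p.2}) ⟨_, 0, rfl⟩
  have hmax : ∀ x y, θ (k + 1) x y → θ k x y := fun x y h =>
    hS ⟨k + 1, rfl⟩ (fun p (hp : θ k p.1 p.2) =>
      Relation.ReflTransGen.mono (fun _ _ => Link.mono_succ hsucc) _ _ hp) (a := (x, y)) h
  have hsymm : ∀ x y, θ k x y → θ k y x := fun x y h => Link.reflTransGen_symm h
  have hdown : ∀ x y x' y', E x x' → E y y' → θ k x' y' → θ k x y := by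
    intro x y x' y' hx hy h
    apply hmax
    have h' : ∀ z, θ k x' z → ∀ w, E w z → θ (k + 1) x w := by
      intro z hz
      induction hz with
      | refl =>
        intro w hw
        obtain ⟨v, -, hv⟩ := Steps.exists_right (T := E) (B := Set.univ) (by simpa using hsucc)
          (k + 1) x' trivial
        exact .single ⟨v, ⟨x', hx, hv⟩, ⟨x', hw, hv⟩⟩
      | tail _ hl ih =>
        rename_i z₁ z₂ _
        intro w hw
        obtain ⟨v, h1, h2⟩ := hl
        obtain ⟨w₁, hw₁⟩ := hpred z₁
        exact (ih w₁ hw₁).tail ⟨v, ⟨z₁, hw₁, h1⟩, ⟨z₂, hw, h2⟩⟩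
    exact h' y' h y hy
  refine ⟨k, hdown, ?_⟩
  let s : Setoid V := ⟨θ k, fun _ => .refl, fun h => hsymm _ _ h, fun h1 h2 => h1.trans h2⟩
  choose r hr using hpred
  let P : Quotient s → Quotient s := Quotient.map r fun x y h => hdown _ _ _ _ (hr x) (hr y) h
  have hP : ∀ x x', E x x' → P (Quotient.mk s x') = Quotient.mk s x := fun x x' h =>
    Quotient.sound (hdown _ _ _ _ (hr x') h .refl)
  -- Taking predecessors is well defined and surjective on finitely many classes, hence injective,
  -- which gives the forward direction.
  have hinj : Function.Injective P := by
    rw [Finite.injective_iff_surjective]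
    intro q
    induction q using Quotient.inductionOn with
    | h x =>
      obtain ⟨y, hy⟩ := hsucc x
      exact ⟨_, hP x y hy⟩
  intro x y x' y' hx hy h
  refine Quotient.exact (s := s) (hinj ?_)
  rw [hP _ _ hx, hP _ _ hy]
  exact Quotient.sound h

/-- B is the linkedness class of the vertex a from `hlevel`. Edges out of B end in the class of g a,
which is g B because G preserves linkedness. -/
theorem exists_goodPair [Finite V] (hG : ActsOn G E) (hsucc : ∀ x, ∃ y, E x y)
    (hpred : ∀ y, ∃ x, E x y)
    (hlevel : ∀ (θ : Setoid V),
      (∀ x y x' y', E x x' → E y y' → (θ x y ↔ θ x' y')) →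
      ∃ a, ∃ g ∈ G, ∀ b, E a b → θ b (g a)) :
    ∃ B g, GoodPair E G B g := by
  classical
  obtain ⟨k, hdown, hup⟩ := exists_linked_classes hsucc hpred
  let θ : V → V → Prop := Relation.ReflTransGen (Link E (k + 1))
  have hsymm : ∀ {x y}, θ x y → θ y x := fun {x y} h => Link.reflTransGen_symm h
  have hsteps : ∀ h ∈ G, ∀ n x y, Steps E n x y → Steps E n (h x) (h y) := by
    intro h hh n
    induction n with
    | zero => exact fun x y hxy => congrArg h hxy
    | succ n ih => exact fun x y ⟨z, hz, hzy⟩ => ⟨h z, (hG h hh _ _).2 hz, ih _ _ hzy⟩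
  have hθG : ∀ h ∈ G, ∀ x y, θ x y → θ (h x) (h y) := fun h hh x y hxy =>
    hxy.lift h fun u v ⟨z, h1, h2⟩ => ⟨h z, hsteps h hh _ _ _ h1, hsteps h hh _ _ _ h2⟩
  obtain ⟨a, g, hg, hag⟩ := hlevel ⟨θ, fun _ => .refl, hsymm, fun h1 h2 => h1.trans h2⟩
    fun x y x' y' hx hy => ⟨hup x y x' y' hx hy, hdown x y x' y' hx hy⟩
  obtain ⟨a', ha'⟩ := hsucc a
  have haa : θ a' (g a) := hag a' ha'
  have hinv : ∀ {x}, θ (g a) x → θ a (g⁻¹ x) := fun {x} h => by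
    have := hθG _ (G.inv_mem hg) _ _ h
    simpa using this
  have hnext : ∀ {x x'}, θ a x → E x x' → θ a (g⁻¹ x') := fun {x x'} hx hxx' =>
    hinv ((hsymm haa).trans (hup _ _ _ _ ha' hxx' hx))
  refine ⟨{x | θ a x}, g, hg, ?_, ⟨a, .refl⟩, ?_, ?_, k, ?_⟩
  · intro ι _ f hf x hx
    have := reflTransGen_of_coordinates (L := Link E (k + 1)) (M := Link E (k + 1)) f
      (fun _ => a) x ?_ hx
    · rwa [hf.idem] at this
    · intro i z u v hz huv
      have htw : IsTw E 1 E := fun ι _ f hf x y hxy => hf.pres x y hxy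
      refine (htw.steps hG G.one_mem (k + 1)).link ι f hf _ _ fun j => ?_
      by_cases hj : j = i
      · subst hj
        simpa using huv
      · obtain ⟨s, -, hs⟩ := Steps.exists_right (T := E) (B := Set.univ) (by simpa using hsucc)
          (k + 1) (z j) trivial
        simpa [hj] using ⟨s, hs, hs⟩
  · intro x hx
    obtain ⟨x', hxx'⟩ := hsucc x
    exact ⟨g⁻¹ x', hnext hx hxx', by simpa using hxx'⟩
  · intro y hy
    obtain ⟨x, hx⟩ := hpred (g y)
    exact ⟨x, hdown _ _ _ _ ha' hx (haa.trans (hθG g hg _ _ hy)), hx⟩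
  -- Applying g⁻ⁱ to the i-th vertex turns a walk from B into a twisted walk inside B; both halves
  -- of a link keep a common end.
  · have hlift : ∀ n x z, θ a x → Steps E n x z →
        Steps (twist E {x | θ a x} g) n x ((g ^ n)⁻¹ z) := by
      intro n
      induction n with
      | zero =>
        rintro x z hx rfl
        simp [Steps]
      | succ n ih =>
        rintro x z hx ⟨y, hxy, hyz⟩
        refine ⟨g⁻¹ y, ⟨hx, hnext hx hxy, by simpa using hxy⟩, ?_⟩
        have := ih (g⁻¹ y) (g⁻¹ z) (hnext hx hxy) (hsteps _ (G.inv_mem hg) _ _ _ hyz)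
        rwa [← Equiv.Perm.mul_apply, ← mul_inv_rev, ← pow_succ'] at this
    intro c hc d hd
    have hcd : θ c d := (hsymm hc).trans hd
    clear hd
    induction hcd with
    | refl => exact .refl
    | tail h hl ih =>
      obtain ⟨z, h1, h2⟩ := hl
      have hb := Relation.ReflTransGen.trans hc h
      exact ih.tail ⟨_, hlift _ _ _ hb h1,
        hlift _ _ _ (hb.tail ⟨z, h1, h2⟩) h2⟩

end LoopLemma

/-! ### Levels in the factor digraph and conclusion -/

/-- A walk of algebraic length `n` in the factor digraph moves by `n` levels. -/
theorem Digraph.exists_of_walk_factor {V : Type u} (A : Digraph V) (G : Subgroup (Equiv.Perm V))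
    (hG : G ≤ A.aut) {Q : Type*} (cl : V → Q) (p : Equiv.Perm Q)
    (hp : ∀ a b, A.Adj a b → cl b = p (cl a)) :
    ∀ {O O' : MulAction.orbitRel.Quotient G V} (w : (A.factor G).Walk O O') (x : V),
      (Quotient.mk (MulAction.orbitRel G V) x : MulAction.orbitRel.Quotient G V) = O →
      ∃ y, (Quotient.mk (MulAction.orbitRel G V) y : MulAction.orbitRel.Quotient G V) = O' ∧
        cl y = (p ^ w.algLength) (cl x) := by
  have horb : ∀ x a, (Quotient.mk (MulAction.orbitRel G V) x : MulAction.orbitRel.Quotient G V) =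
      Quotient.mk (MulAction.orbitRel G V) a → ∃ h ∈ G, h a = x := by
    intro x a hxa
    obtain ⟨h, hh⟩ := MulAction.orbitRel_apply.1 (Quotient.exact hxa)
    exact ⟨h, h.2, hh⟩
  have horb' : ∀ h ∈ G, ∀ a,
      (Quotient.mk (MulAction.orbitRel G V) (h a) : MulAction.orbitRel.Quotient G V) =
      Quotient.mk (MulAction.orbitRel G V) a := fun h hh a =>
    Quotient.sound (MulAction.orbitRel_apply.2 ⟨⟨h, hh⟩, rfl⟩)
  intro O O' w
  induction w with
  | nil O => exact fun x hx => ⟨x, hx, by simp [Walk.algLength]⟩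
  | forward h w ih =>
    intro x hx
    obtain ⟨a, b, rfl, rfl, hab⟩ := h
    -- The witnessing edge need not start at the current vertex; an automorphism in G translates it
    -- there.
    obtain ⟨t, ht, rfl⟩ := horb _ _ hx
    obtain ⟨y, hy, hyx⟩ := ih (t b) (horb' t ht b)
    refine ⟨y, hy, ?_⟩
    change _ = (p ^ (w.algLength + 1)) _
    rw [hyx, hp _ _ ((hG ht a b).2 hab), zpow_add_one, Equiv.Perm.mul_apply]
  | backward h w ih =>
    intro x hx
    obtain ⟨b, a, rfl, rfl, hba⟩ := h
    obtain ⟨t, ht, rfl⟩ := horb _ _ hx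
    obtain ⟨y, hy, hyx⟩ := ih (t b) (horb' t ht b)
    refine ⟨y, hy, ?_⟩
    change _ = (p ^ (w.algLength - 1)) _
    rw [hyx, hp _ _ ((hG ht b a).2 hba), zpow_sub_one, Equiv.Perm.mul_apply]
    simp

/-- Edges induce a permutation p of the classes. Lifting the closed walk of algebraic length 1 from
a ends at some g a whose class is p of the class of a, the class of all successors of a. -/
theorem Digraph.exists_goodPair {V : Type u} [Finite V] (A : Digraph V) (hA : A.IsSmooth)
    (G : Subgroup (Equiv.Perm V)) (hG : G ≤ A.aut) (hlen : (A.factor G).HasAlgLengthOne) :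
    ∃ B g, GoodPair A.Adj G B g := by
  refine _root_.exists_goodPair (fun h hh => hG hh) (fun x => (hA x).1) (fun x => (hA x).2) ?_
  intro θ hθE
  choose s hs using fun x => (hA x).1
  choose r hr using fun x => (hA x).2
  let p : Equiv.Perm (Quotient θ) :=
    { toFun := Quotient.map s fun x y h => (hθE _ _ _ _ (hs x) (hs y)).1 h
      invFun := Quotient.map r fun x y h => (hθE _ _ _ _ (hr x) (hr y)).2 h
      left_inv := fun q => Quotient.inductionOn q fun x =>
        Quotient.sound ((hθE _ _ _ _ (hr (s x)) (hs x)).2 (θ.refl _))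
      right_inv := fun q => Quotient.inductionOn q fun x =>
        Quotient.sound ((hθE _ _ _ _ (hs (r x)) (hr x)).1 (θ.refl _)) }
  have hp : ∀ a b, A.Adj a b → (Quotient.mk θ b) = p (Quotient.mk θ a) := fun a b hab =>
    Quotient.sound ((hθE _ _ _ _ hab (hs a)).1 (θ.refl _))
  obtain ⟨O, w, hw⟩ := hlen
  obtain ⟨a, rfl⟩ := Quotient.exists_rep O
  obtain ⟨y, hy, hya⟩ := A.exists_of_walk_factor G hG (Quotient.mk θ) p hp w a rfl
  obtain ⟨g, rfl⟩ := MulAction.orbitRel_apply.1 (Quotient.exact hy)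
  refine ⟨a, g, g.2, fun b hab => Quotient.exact (s := θ) ?_⟩
  rw [hp a b hab]
  rw [hw, zpow_one] at hya
  exact hya.symm

theorem theorem2 {V : Type*} [Finite V] (A : Digraph V) (hA : A.IsSmooth)
    (G : Subgroup (Equiv.Perm V)) (hG : G ≤ A.aut)
    (hlen : (A.factor G).HasAlgLengthOne) (hloop : ¬ (A.factor G).HasLoop)
    (L : FirstOrder.Language) [L.IsRelational]
    (B : Type*) [Finite B] [L.Structure B] :
    A.PPInterpretsWithParams L B := by
  by_contra hno
  have hE : ¬ Projective A.Adj := fun h => hno (A.ppInterprets_of_projective h L B)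
  obtain ⟨C, g, hC⟩ := A.exists_goodPair hA G hG hlen
  obtain ⟨x, hx⟩ := hC.exists_loop hE fun h hh => hG hh
  exact hloop ⟨Quotient.mk _ x, x, g x, rfl,
    Quotient.sound (MulAction.orbitRel_apply.2 ⟨⟨g, hC.mem⟩, rfl⟩), hx⟩
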